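/- There is an algorithm (a program of a random access machine with unit-cost addition, truncated subtraction, tests for zero and indirect addressing) with the following property. Its input is a semi-complete digraph $T$ on $n$ vertices, given by its adjacency matrix, and a nonnegative integer $k$; here a digraph is semi-complete if it has no loops and no multiple arcs and every two distinct vertices $v,w$ are joined by at least one of the arcs $(v,w)$, $(w,v)$. The width of an ordering $(v_1,\dots,v_n)$ of $V(T)$ is the maximum over $1\le t\le n-1$ of the number of arcs of $T$ directed from $\{v_{t+1},\dots,v_n\}$ to $\{v_1,\dots,v_t\}$ (and $0$ if $n\le 1$), and the cutwidth of $T$ is the smallest width of an ordering of $V(T)$. In time $2^{O(\sqrt{k\log k})}\cdot n^{O(1)}$, that is, in at most $c\cdot 2^{c\sqrt{k\log k}}\cdot (n+1)^{c}$ steps for a constant $c$ that depends on nothing (with $k\log k=0$ for $k=0$), the algorithm either outputs an ordering of $V(T)$ of width at most $k$ or correctly concludes that the cutwidth of $T$ is greater than $k$. -/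

import Mathlib

/-! ## Semi-complete digraphs, orderings, cutwidth -/

section Cutwidth

variable {n : ℕ}

/-- A digraph is semi-complete if it has no loops and any two distinct vertices are joined by at
least one arc; both arcs may be present. (A `Digraph` never has multiple arcs.) -/
def Digraph.IsSemicomplete (T : Digraph (Fin n)) : Prop :=
  (∀ v, ¬ T.Adj v v) ∧ ∀ v w, v ≠ w → T.Adj v w ∨ T.Adj w v

open Classical in
/-- `E(A, B)`: the set of arcs directed from a vertex of `A` to a vertex of `B`. -/
noncomputable def Digraph.arcsBetween (T : Digraph (Fin n)) (A B : Finset (Fin n)) :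
    Finset (Fin n × Fin n) :=
  (A ×ˢ B).filter fun e => T.Adj e.1 e.2

/-- An ordering of the vertices is a permutation `σ` of `Fin n`, the vertex in position `i`
(counted from `0`) being `σ i`. This is the set of the first `t` vertices of the ordering. -/
def orderPrefix (σ : Equiv.Perm (Fin n)) (t : ℕ) : Finset (Fin n) :=
  Finset.univ.filter fun v => (σ.symm v : ℕ) < t

/-- The width of an ordering: the maximum, over `1 ≤ t ≤ n - 1`, of the number of arcs directed
from the vertices after position `t` to the first `t` vertices (`0` if `n ≤ 1`). -/
noncomputable def Digraph.orderWidth (T : Digraph (Fin n)) (σ : Equiv.Perm (Fin n)) : ℕ :=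
  (Finset.Ico 1 n).sup fun t => (T.arcsBetween (orderPrefix σ t)ᶜ (orderPrefix σ t)).card

/-- The cutwidth: the smallest width of an ordering of the vertices. -/
noncomputable def Digraph.cutwidth (T : Digraph (Fin n)) : ℕ :=
  ⨅ σ : Equiv.Perm (Fin n), T.orderWidth σ

end Cutwidth

/-! ## Random access machine with a step count

The memory is an infinite array of natural numbers. Programs are finite and are built from stores,
conditionals and loops; expressions may read memory at computed addresses. The only arithmetic is
addition and truncated subtraction, so unit cost is realistic: within `t` steps the bit length of
a number grows by at most `t`, and the model is polynomially equivalent to Turing machines. -/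

namespace RAM

/-- The memory: the content of each cell. -/
abbrev Memory : Type := ℕ → ℕ

/-- Expressions. -/
inductive Expr : Type
  /-- a constant -/
  | const (c : ℕ) : Expr
  /-- the content of the memory cell whose address is the value of `e` -/
  | cell (e : Expr) : Expr
  /-- sum -/
  | add (e f : Expr) : Expr
  /-- truncated difference -/
  | sub (e f : Expr) : Expr

/-- The value of an expression. -/
def Expr.eval (m : Memory) : Expr → ℕ
  | const c => c
  | cell e => m (e.eval m)
  | add e f => e.eval m + f.eval m
  | sub e f => e.eval m - f.eval m

/-- The time to evaluate an expression: one unit for each constant, memory read and arithmetic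
operation. -/
def Expr.cost : Expr → ℕ
  | const _ => 1
  | cell e => e.cost + 1
  | add e f => e.cost + f.cost + 1
  | sub e f => e.cost + f.cost + 1

/-- Programs. -/
inductive Program : Type
  /-- do nothing -/
  | skip : Program
  /-- write the value of `e` into the cell whose address is the value of `a` -/
  | store (a e : Expr) : Program
  /-- run `p`, then `q` -/
  | seq (p q : Program) : Program
  /-- run `p` if the value of `e` is nonzero, otherwise run `q` -/
  | ite (e : Expr) (p q : Program) : Program
  /-- while the value of `e` is nonzero, run `p` -/
  | loop (e : Expr) (p : Program) : Program

/-- `Runs p m t m'`: the program `p`, started on the memory `m`, halts after exactly `t` units of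
time with the memory `m'`. -/
inductive Runs : Program → Memory → ℕ → Memory → Prop
  | skip (m : Memory) : Runs .skip m 1 m
  | store (a e : Expr) (m : Memory) :
      Runs (.store a e) m (a.cost + e.cost + 1) (Function.update m (a.eval m) (e.eval m))
  | seq {p q : Program} {m m' m'' : Memory} {t t' : ℕ} :
      Runs p m t m' → Runs q m' t' m'' → Runs (.seq p q) m (t + t') m''
  | ite_true {e : Expr} {p q : Program} {m m' : Memory} {t : ℕ} :
      e.eval m ≠ 0 → Runs p m t m' → Runs (.ite e p q) m (e.cost + 1 + t) m'
  | ite_false {e : Expr} {p q : Program} {m m' : Memory} {t : ℕ} :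
      e.eval m = 0 → Runs q m t m' → Runs (.ite e p q) m (e.cost + 1 + t) m'
  | loop_true {e : Expr} {p : Program} {m m' m'' : Memory} {t t' : ℕ} :
      e.eval m ≠ 0 → Runs p m t m' → Runs (.loop e p) m' t' m'' →
      Runs (.loop e p) m (e.cost + 1 + t + t') m''
  | loop_false {e : Expr} {p : Program} {m : Memory} :
      e.eval m = 0 → Runs (.loop e p) m (e.cost + 1) m

/-- The machine is deterministic: running time and final memory are determined by the program and
the initial memory. -/
theorem Runs.deterministic {p : Program} {m m₁ : Memory} {t₁ : ℕ} (h₁ : Runs p m t₁ m₁) :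
    ∀ {t₂ : ℕ} {m₂ : Memory}, Runs p m t₂ m₂ → t₁ = t₂ ∧ m₁ = m₂ := by
  induction h₁ with
  | skip m => intro t₂ m₂ h; cases h; exact ⟨rfl, rfl⟩
  | store a e m => intro t₂ m₂ h; cases h; exact ⟨rfl, rfl⟩
  | seq _ _ ih ih' =>
    intro t₂ m₂ h
    cases h with
    | seq g g' =>
      obtain ⟨rfl, rfl⟩ := ih g
      obtain ⟨rfl, rfl⟩ := ih' g'
      exact ⟨rfl, rfl⟩
  | ite_true he _ ih =>
    intro t₂ m₂ h
    cases h with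
    | ite_true _ g => obtain ⟨rfl, rfl⟩ := ih g; exact ⟨rfl, rfl⟩
    | ite_false he' _ => exact absurd he' he
  | ite_false he _ ih =>
    intro t₂ m₂ h
    cases h with
    | ite_true he' _ => exact absurd he he'
    | ite_false _ g => obtain ⟨rfl, rfl⟩ := ih g; exact ⟨rfl, rfl⟩
  | loop_true he _ _ ih ih' =>
    intro t₂ m₂ h
    cases h with
    | loop_true _ g g' =>
      obtain ⟨rfl, rfl⟩ := ih g
      obtain ⟨rfl, rfl⟩ := ih' g'
      exact ⟨rfl, rfl⟩
    | loop_false he' => exact absurd he' he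
  | loop_false he =>
    intro t₂ m₂ h
    cases h with
    | loop_true he' _ _ => exact absurd he he'
    | loop_false _ => exact ⟨rfl, rfl⟩

open Classical in
/-- The initial memory for the input `(T, k)`: cell `0` holds the number `n` of vertices, cell `1`
holds `k`, the next `n * n` cells hold the adjacency matrix of `T` row by row (cell
`2 + (u * n + v)` holds `1` if `(u, v)` is an arc and `0` if not), and all other cells hold `0`. -/
noncomputable def inputMemory {n : ℕ} (T : Digraph (Fin n)) (k : ℕ) : Memory := fun a =>
  if a = 0 then n
  else if a = 1 then k
  else if ∃ u v : Fin n, a = 2 + ((u : ℕ) * n + (v : ℕ)) ∧ T.Adj u v then 1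
  else 0

/-- The memory `m` holds the answer "yes, and the ordering is `σ`": cell `0` holds `1`, and the
`n` cells after it list the vertices in the order given by `σ`. -/
def OutputsOrdering {n : ℕ} (m : Memory) (σ : Equiv.Perm (Fin n)) : Prop :=
  m 0 = 1 ∧ ∀ i : Fin n, m (1 + (i : ℕ)) = (σ i : ℕ)

/-- The memory `m` holds the answer "no": cell `0` holds `0`. -/
def OutputsNo (m : Memory) : Prop :=
  m 0 = 0

end RAM

/-! ## Machine programs on a store of named arrays -/

namespace RAM

/-- A store of `22` infinite arrays; an array is used as a register through its entry `0`. -/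
abbrev Store : Type := Fin 22 → ℕ → ℕ

/-- The store `v` with entry `x` of array `j` replaced by `y`. -/
def Store.set (v : Store) (j : Fin 22) (x y : ℕ) : Store :=
  fun j' x' => if j' = j ∧ x' = x then y else v j' x'

/-- The memory that holds the base address `b` in cell `0`, the contents `low` in the other cells
below `b`, and from `b` on the arrays of `v`, interleaved. -/
def layout (b : ℕ) (low : ℕ → ℕ) (v : Store) : Memory := fun a =>
  if a = 0 then b else if a < b then low a
  else v ⟨(a - b) % 22, Nat.mod_lt _ (by norm_num)⟩ ((a - b) / 22)

theorem layout_zero (b : ℕ) (low : ℕ → ℕ) (v : Store) : layout b low v 0 = b := by simp [layout]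

theorem layout_low {b a : ℕ} (low : ℕ → ℕ) (v : Store) (h0 : a ≠ 0) (h : a < b) :
    layout b low v a = low a := by simp [layout, h0, h]

theorem layout_array {b : ℕ} (hb : 0 < b) (low : ℕ → ℕ) (v : Store) (j : Fin 22) (x : ℕ) :
    layout b low v (b + 22 * x + j) = v j x := by
  have h1 : b + 22 * x + (j : ℕ) ≠ 0 := by omega
  have h2 : ¬ b + 22 * x + (j : ℕ) < b := by omega
  have h3 : (b + 22 * x + (j : ℕ) - b) = 22 * x + j := by omega
  have h4 : (22 * x + (j : ℕ)) / 22 = x := by omega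
  have h5 : (22 * x + (j : ℕ)) % 22 = j := by omega
  simp only [layout, h1, h2, if_false, h3, h4, h5]

theorem update_layout_array {b : ℕ} (hb : 0 < b) (low : ℕ → ℕ) (v : Store) (j : Fin 22)
    (x y : ℕ) :
    Function.update (layout b low v) (b + 22 * x + j) y = layout b low (v.set j x y) := by
  funext a
  by_cases ha0 : a = 0
  · subst ha0
    rw [Function.update_of_ne (by omega)]
    simp [layout]
  by_cases hab : a < b
  · rw [Function.update_of_ne (by omega)]
    simp [layout, ha0, hab]
  obtain ⟨j', x', rfl⟩ : ∃ (j' : Fin 22) (x' : ℕ), a = b + 22 * x' + j' :=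
    ⟨⟨(a - b) % 22, Nat.mod_lt _ (by norm_num)⟩, (a - b) / 22, by simp only []; omega⟩
  rw [layout_array hb, Store.set, Function.update_apply, layout_array hb]
  refine if_congr ⟨fun h => ?_, ?_⟩ rfl rfl
  · have := j.isLt
    have := j'.isLt
    exact ⟨Fin.ext (by omega), by omega⟩
  · rintro ⟨rfl, rfl⟩; rfl

theorem update_layout_low {b a : ℕ} (low : ℕ → ℕ) (v : Store) (y : ℕ) (h0 : a ≠ 0) (h : a < b) :
    Function.update (layout b low v) a y = layout b (Function.update low a y) v := by
  funext a'
  by_cases ha : a' = a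
  · subst ha
    simp [layout, h0, h]
  · simp [layout, ha]

/-- Expressions over a store. -/
inductive SExpr : Type
  /-- a constant -/
  | const (c : ℕ) : SExpr
  /-- an entry of an array -/
  | rd (j : Fin 22) (e : SExpr) : SExpr
  /-- sum -/
  | add (e f : SExpr) : SExpr
  /-- truncated difference -/
  | sub (e f : SExpr) : SExpr

/-- The value of an expression over a store. -/
def SExpr.eval (v : Store) : SExpr → ℕ
  | const c => c
  | rd j e => v j (e.eval v)
  | add e f => e.eval v + f.eval v
  | sub e f => e.eval v - f.eval v

/-- The multiple `c * e`, by repeated addition. -/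
def Expr.times (e : Expr) : ℕ → Expr
  | 0 => .const 0
  | c + 1 => .add (e.times c) e

theorem Expr.eval_times (m : Memory) (e : Expr) (c : ℕ) : (e.times c).eval m = c * e.eval m := by
  induction c with
  | zero => simp [Expr.times, Expr.eval]
  | succ c ih => simp [Expr.times, Expr.eval, ih, Nat.succ_mul]

/-- The address of entry `e` of array `j`. -/
def arrayAddr (j : Fin 22) (e : Expr) : Expr :=
  .add (.add (.cell (.const 0)) (e.times 22)) (.const j)

/-- The machine expression for an expression over a store. -/
def SExpr.compile : SExpr → Expr
  | const c => .const c
  | rd j e => .cell (arrayAddr j e.compile)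
  | add e f => .add e.compile f.compile
  | sub e f => .sub e.compile f.compile

theorem eval_arrayAddr (b : ℕ) (low : ℕ → ℕ) (v : Store) (j : Fin 22) (e : Expr) :
    (arrayAddr j e).eval (layout b low v) = b + 22 * e.eval (layout b low v) + j := by
  simp [arrayAddr, Expr.eval, Expr.eval_times, layout_zero]

theorem SExpr.eval_compile {b : ℕ} (hb : 0 < b) (low : ℕ → ℕ) (v : Store) (e : SExpr) :
    e.compile.eval (layout b low v) = e.eval v := by
  induction e with
  | const c => rfl
  | rd j e ih => rw [compile, Expr.eval, eval_arrayAddr, ih, layout_array hb, eval]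
  | add e f ihe ihf => rw [compile, Expr.eval, ihe, ihf, eval]
  | sub e f ihe ihf => rw [compile, Expr.eval, ihe, ihf, eval]

/-- `Exec p v t v'`: in every layout, `p` takes the store `v` to `v'` within time `t`. -/
def Exec (p : Program) (v : Store) (t : ℕ) (v' : Store) : Prop :=
  ∀ (b : ℕ) (low : ℕ → ℕ), 0 < b →
    ∃ t' ≤ t, Runs p (layout b low v) t' (layout b low v')

theorem Exec.mono {p : Program} {v v' : Store} {t t' : ℕ} (h : Exec p v t v') (ht : t ≤ t') :
    Exec p v t' v' := fun b low hb =>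
  let ⟨s, hs, hr⟩ := h b low hb
  ⟨s, hs.trans ht, hr⟩

theorem Exec.seq {p q : Program} {v v' v'' : Store} {t t' : ℕ} (h : Exec p v t v')
    (h' : Exec q v' t' v'') : Exec (.seq p q) v (t + t') v'' := fun b low hb =>
  let ⟨_, hs, hr⟩ := h b low hb
  let ⟨_, hs', hr'⟩ := h' b low hb
  ⟨_, add_le_add hs hs', hr.seq hr'⟩

/-- Programs without loops over a store. -/
inductive Block : Type
  /-- do nothing -/
  | skip : Block
  /-- write the value of `e` into the entry of array `j` whose index is the value of `a` -/
  | wr (j : Fin 22) (a e : SExpr) : Block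
  /-- run `p`, then `q` -/
  | seq (p q : Block) : Block
  /-- run `p` if the value of `e` is nonzero, otherwise run `q` -/
  | ite (e : SExpr) (p q : Block) : Block

/-- The machine program for a program without loops. -/
def Block.compile : Block → Program
  | skip => .skip
  | wr j a e => .store (arrayAddr j a.compile) e.compile
  | seq p q => .seq p.compile q.compile
  | ite e p q => .ite e.compile p.compile q.compile

/-- The effect of a program without loops. -/
def Block.run : Block → Store → Store
  | skip, v => v
  | wr j a e, v => v.set j (a.eval v) (e.eval v)
  | seq p q, v => q.run (p.run v)
  | ite e p q, v => if e.eval v ≠ 0 then p.run v else q.run v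

/-- A bound on the running time of a program without loops. -/
def Block.time : Block → ℕ
  | skip => 1
  | wr j a e => (arrayAddr j a.compile).cost + e.compile.cost + 1
  | seq p q => p.time + q.time
  | ite e p q => e.compile.cost + 1 + (p.time + q.time)

theorem Block.exec (p : Block) (v : Store) : Exec p.compile v p.time (p.run v) := by
  induction p generalizing v with
  | skip => exact fun b low hb => ⟨1, le_rfl, .skip _⟩
  | wr j a e =>
    intro b low hb
    refine ⟨_, le_rfl, ?_⟩
    have := Runs.store (arrayAddr j a.compile) e.compile (layout b low v)
    rwa [eval_arrayAddr, SExpr.eval_compile hb, SExpr.eval_compile hb,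
      update_layout_array hb] at this
  | seq p q ihp ihq => exact (ihp v).seq (ihq _)
  | ite e p q ihp ihq =>
    intro b low hb
    by_cases he : e.eval v = 0
    · obtain ⟨t, ht, hr⟩ := ihq v b low hb
      have hrun : (ite e p q).run v = q.run v := by simp [run, he]
      rw [hrun]
      exact ⟨e.compile.cost + 1 + t, by simp only [time]; omega,
        .ite_false ((SExpr.eval_compile hb low v e).trans he) hr⟩
    · obtain ⟨t, ht, hr⟩ := ihp v b low hb
      have hrun : (ite e p q).run v = p.run v := by simp [run, he]
      rw [hrun]
      exact ⟨e.compile.cost + 1 + t, by simp only [time]; omega,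
        .ite_true (by rwa [SExpr.eval_compile hb]) hr⟩

theorem Exec.ite_true {e : SExpr} {p q : Program} {v v' : Store} {t : ℕ} (he : e.eval v ≠ 0)
    (h : Exec p v t v') : Exec (.ite e.compile p q) v (e.compile.cost + 1 + t) v' :=
  fun b low hb =>
    let ⟨_, hs, hr⟩ := h b low hb
    ⟨_, by omega, .ite_true (by rwa [SExpr.eval_compile hb]) hr⟩

theorem Exec.ite_false {e : SExpr} {p q : Program} {v v' : Store} {t : ℕ} (he : e.eval v = 0)
    (h : Exec q v t v') : Exec (.ite e.compile p q) v (e.compile.cost + 1 + t) v' :=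
  fun b low hb =>
    let ⟨_, hs, hr⟩ := h b low hb
    ⟨_, by omega, .ite_false (by rwa [SExpr.eval_compile hb]) hr⟩

theorem Runs.loop_of_invariant {e : Expr} {p : Program} {t N : ℕ} (Inv : ℕ → Memory → Prop)
    (hstep : ∀ i < N, ∀ m, Inv i m → e.eval m ≠ 0 ∧ ∃ s ≤ t, ∃ m', Runs p m s m' ∧ Inv (i + 1) m')
    (hend : ∀ m, Inv N m → e.eval m = 0) {m : Memory} (h0 : Inv 0 m) :
    ∃ s ≤ (N + 1) * (t + e.cost + 1), ∃ m', Runs (.loop e p) m s m' ∧ Inv N m' := by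
  suffices H : ∀ d i, i + d = N → ∀ m, Inv i m →
      ∃ s ≤ (d + 1) * (t + e.cost + 1), ∃ m', Runs (.loop e p) m s m' ∧ Inv N m' from
    H N 0 (zero_add N) m h0
  intro d
  induction d with
  | zero =>
    rintro i rfl m hm
    exact ⟨_, by omega, m, .loop_false (hend m hm), hm⟩
  | succ d ih =>
    intro i hi m hm
    obtain ⟨he, s, hs, m', hr, hm'⟩ := hstep i (by omega) m hm
    obtain ⟨s', hs', m'', hr', hm''⟩ := ih (i + 1) (by omega) m' hm'
    refine ⟨_, ?_, m'', .loop_true he hr hr', hm''⟩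
    rw [Nat.succ_mul]
    omega

theorem Exec.loop_of_invariant {e : SExpr} {p : Program} {t : ℕ} (N : ℕ)
    (Inv : ℕ → Store → Prop) {v : Store} (h0 : Inv 0 v)
    (hstep : ∀ i < N, ∀ v, Inv i v → e.eval v ≠ 0 ∧ ∃ v', Exec p v t v' ∧ Inv (i + 1) v')
    (hend : ∀ v, Inv N v → e.eval v = 0) :
    ∃ v', Exec (.loop e.compile p) v ((N + 1) * (t + e.compile.cost + 1)) v' ∧ Inv N v' := by
  suffices H : ∀ d i, i + d = N → ∀ v, Inv i v →
      ∃ v', Exec (.loop e.compile p) v ((d + 1) * (t + e.compile.cost + 1)) v' ∧ Inv N v' from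
    H N 0 (zero_add N) v h0
  intro d
  induction d with
  | zero =>
    rintro i rfl v hv
    exact ⟨v, fun b low hb => ⟨_, by omega,
      .loop_false ((SExpr.eval_compile hb low v e).trans (hend v hv))⟩, hv⟩
  | succ d ih =>
    intro i hi v hv
    obtain ⟨he, v', hx, hv'⟩ := hstep i (by omega) v hv
    obtain ⟨v'', hx', hv''⟩ := ih (i + 1) (by omega) v' hv'
    refine ⟨v'', fun b low hb => ?_, hv''⟩
    obtain ⟨s, hs, hr⟩ := hx b low hb
    obtain ⟨s', hs', hr'⟩ := hx' b low hb
    refine ⟨_, ?_, .loop_true (by rwa [SExpr.eval_compile hb]) hr hr'⟩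
    rw [Nat.succ_mul]
    omega

end RAM

/-! ## Finsets with a narrow profile -/

section Narrow

open Finset

/-- At most `K / x` elements of `D` are at least `x`. -/
def IsNarrow (K : ℕ) (D : Finset ℕ) : Prop :=
  ∀ x, (D.filter fun d => x ≤ d).card * x ≤ K

theorem IsNarrow.le {K : ℕ} {D : Finset ℕ} (h : IsNarrow K D) {d : ℕ} (hd : d ∈ D) : d ≤ K := by
  have h1 : 0 < (D.filter fun e => d ≤ e).card :=
    card_pos.2 ⟨d, mem_filter.2 ⟨hd, le_rfl⟩⟩
  exact (Nat.le_mul_of_pos_left d h1).trans (h d)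

theorem IsNarrow.sum_le {K : ℕ} {D : Finset ℕ} (h : IsNarrow K D) :
    ((∑ d ∈ D, d : ℕ) : ℝ) ≤ K * (1 + Real.log K) := by
  have h1 : ∑ d ∈ D, d = ∑ x ∈ Icc 1 K, (D.filter fun d => x ≤ d).card := by
    have h2 : ∀ d ∈ D, d = ((Icc 1 K).filter fun x => x ≤ d).card := by
      intro d hd
      have h3 : ((Icc 1 K).filter fun x => x ≤ d) = Icc 1 d := by
        ext x
        have := h.le hd
        simp only [mem_filter, mem_Icc]
        omega
      rw [h3, Nat.card_Icc, Nat.add_sub_cancel]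
    rw [sum_congr rfl h2]
    simp only [card_filter]
    exact sum_comm
  have h4 : ((∑ d ∈ D, d : ℕ) : ℝ) ≤ ∑ x ∈ Icc 1 K, (K : ℝ) * (x : ℝ)⁻¹ := by
    rw [h1, Nat.cast_sum]
    refine sum_le_sum fun x hx => ?_
    have hx0 : (0 : ℝ) < x := by exact_mod_cast (mem_Icc.1 hx).1
    rw [← div_eq_mul_inv, le_div_iff₀ hx0]
    exact_mod_cast h x
  rw [← mul_sum] at h4
  have h5 := harmonic_le_one_add_log K
  rw [harmonic_eq_sum_Icc] at h5
  push_cast at h5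
  exact h4.trans (mul_le_mul_of_nonneg_left h5 (Nat.cast_nonneg K))

theorem Real.inv_one_sub_exp_neg_inv_le {s : ℝ} (hs : 0 < s) :
    (1 - Real.exp (-s⁻¹))⁻¹ ≤ 1 + s := by
  have h1 := Real.add_one_le_exp s⁻¹
  have h2 : Real.exp (-s⁻¹) ≤ (s⁻¹ + 1)⁻¹ := by
    rw [Real.exp_neg]
    exact inv_anti₀ (by positivity) h1
  have h3 : (1 + s)⁻¹ = 1 - (s⁻¹ + 1)⁻¹ := by field_simp; ring
  rw [inv_le_comm₀ _ (by positivity), h3]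
  · linarith
  · have : (0 : ℝ) < (1 + s)⁻¹ := by positivity
    linarith

/-- A bound on the square root of the sum of a narrow finset. -/
noncomputable def narrowScale (K : ℕ) : ℝ := Real.sqrt (K * (1 + Real.log K) + 1)

theorem card_narrow_le (K : ℕ) (F : Finset (Finset ℕ)) (hF : ∀ D ∈ F, IsNarrow K D) :
    (F.card : ℝ) ≤ Real.exp (2 * narrowScale K + 1) := by
  set s := narrowScale K with hs
  have hlog : 0 ≤ (K : ℝ) * (1 + Real.log K) :=
    mul_nonneg K.cast_nonneg (add_nonneg zero_le_one (Real.log_natCast_nonneg K))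
  have hs0 : 0 < s := Real.sqrt_pos.2 (by linarith)
  have hss : s * s = K * (1 + Real.log K) + 1 := Real.mul_self_sqrt (by linarith)
  have hsub : F ⊆ (range (K + 1)).powerset := fun D hD =>
    mem_powerset.2 fun d hd => mem_range.2 (Nat.lt_succ_of_le ((hF D hD).le hd))
  have h1 : (F.card : ℝ) * Real.exp (-s) ≤ ∑ D ∈ F, ∏ d ∈ D, Real.exp (-s⁻¹) ^ d := by
    rw [← nsmul_eq_mul]
    refine card_nsmul_le_sum _ _ _ fun D hD => ?_
    rw [prod_pow_eq_pow_sum, ← Real.exp_nat_mul, Real.exp_le_exp]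
    have h2 : ((∑ d ∈ D, d : ℕ) : ℝ) ≤ s * s := by
      have := (hF D hD).sum_le
      linarith
    have h3 : ((∑ d ∈ D, d : ℕ) : ℝ) * s⁻¹ ≤ s * s * s⁻¹ :=
      mul_le_mul_of_nonneg_right h2 (by positivity)
    rw [mul_assoc, mul_inv_cancel₀ hs0.ne', mul_one] at h3
    linarith
  have hx0 : 0 < Real.exp (-s⁻¹) := Real.exp_pos _
  have hx1 : Real.exp (-s⁻¹) < 1 := by simpa using hs0
  have h4 : ∑ D ∈ F, ∏ d ∈ D, Real.exp (-s⁻¹) ^ d ≤ Real.exp (1 + s) := by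
    calc ∑ D ∈ F, ∏ d ∈ D, Real.exp (-s⁻¹) ^ d
        ≤ ∑ D ∈ (range (K + 1)).powerset, ∏ d ∈ D, Real.exp (-s⁻¹) ^ d :=
          sum_le_sum_of_subset_of_nonneg hsub fun _ _ _ => by positivity
      _ = ∏ d ∈ range (K + 1), (1 + Real.exp (-s⁻¹) ^ d) := (prod_one_add _).symm
      _ ≤ ∏ d ∈ range (K + 1), Real.exp (Real.exp (-s⁻¹) ^ d) :=
          prod_le_prod (fun _ _ => by positivity) fun d _ => by
            have := Real.add_one_le_exp (Real.exp (-s⁻¹) ^ d)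
            linarith
      _ = Real.exp (∑ d ∈ range (K + 1), Real.exp (-s⁻¹) ^ d) := (Real.exp_sum _ _).symm
      _ ≤ Real.exp (1 + s) := by
          refine Real.exp_le_exp.2 (le_trans ?_ (Real.inv_one_sub_exp_neg_inv_le hs0))
          rw [← tsum_geometric_of_lt_one hx0.le hx1]
          exact (summable_geometric_of_lt_one hx0.le hx1).sum_le_tsum _ fun _ _ => by positivity
  have h5 : (F.card : ℝ) = F.card * Real.exp (-s) * Real.exp s := by
    rw [mul_assoc, ← Real.exp_add, neg_add_cancel, Real.exp_zero, mul_one]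
  rw [h5]
  calc _ ≤ Real.exp (1 + s) * Real.exp s :=
        mul_le_mul_of_nonneg_right (h1.trans h4) (Real.exp_pos _).le
    _ = _ := by rw [← Real.exp_add]; ring_nf

theorem exists_narrowScale_le :
    ∃ a : ℝ, 0 ≤ a ∧ ∀ k : ℕ,
      narrowScale (2 * k) ≤ a + a * Real.sqrt (k * Real.log k) := by
  refine ⟨4, by norm_num, fun k => ?_⟩
  have h2 := Real.log_two_lt_d9
  have h2' := Real.log_two_gt_d9
  rcases Nat.lt_or_ge k 2 with hk | hk
  · rw [narrowScale, Real.sqrt_le_left (by positivity)]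
    have hl : (k : ℝ) * Real.log k = 0 := by
      interval_cases k <;> simp
    rw [hl]
    interval_cases k
    · norm_num
    · norm_num
      linarith
  · have hk' : (2 : ℝ) ≤ k := by exact_mod_cast hk
    have hlk : Real.log 2 ≤ Real.log k := Real.log_le_log (by norm_num) hk'
    have hl : Real.log ((2 * k : ℕ) : ℝ) = Real.log 2 + Real.log k := by
      push_cast
      exact Real.log_mul (by norm_num) (by positivity)
    have h0 : 0 ≤ (k : ℝ) * Real.log k := mul_nonneg (by positivity) (by linarith)
    have h3 : narrowScale (2 * k) ≤ 4 * Real.sqrt (k * Real.log k) := by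
      rw [narrowScale, Real.sqrt_le_left (by positivity), mul_pow, Real.sq_sqrt h0, hl]
      push_cast
      nlinarith
    linarith

end Narrow

/-! ## Cuts and reachable vertex sets -/

section Reachable

open Finset

variable (adj : ℕ → ℕ → Prop) (k : ℕ)

open Classical in
/-- The arcs into `A` from the other vertices below `i`. -/
noncomputable def backArcs (i : ℕ) (A : Finset ℕ) : Finset (ℕ × ℕ) :=
  (range i ×ˢ range i).filter fun e => adj e.1 e.2 ∧ e.1 ∉ A ∧ e.2 ∈ A

/-- The sets that arise from `∅` by adding vertices below `i` one at a time, with at most `k` back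
arcs for every set on the way. -/
inductive Reachable (i : ℕ) : Finset ℕ → Prop
  | empty : Reachable i ∅
  | grow (A : Finset ℕ) (u : ℕ) : Reachable i A → u < i → u ∉ A →
      (backArcs adj i (insert u A)).card ≤ k → Reachable i (insert u A)

variable {adj k}

theorem mem_backArcs {i : ℕ} {A : Finset ℕ} {e : ℕ × ℕ} :
    e ∈ backArcs adj i A ↔ (e.1 < i ∧ e.2 < i) ∧ adj e.1 e.2 ∧ e.1 ∉ A ∧ e.2 ∈ A := by
  simp [backArcs]

theorem backArcs_empty (i : ℕ) : backArcs adj i ∅ = ∅ := by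
  ext e; simp [mem_backArcs]

theorem Reachable.card_le {i : ℕ} {A : Finset ℕ} (h : Reachable adj k i A) :
    (backArcs adj i A).card ≤ k := by
  cases h with
  | empty => simp [backArcs_empty]
  | grow A u _ _ _ h => exact h

theorem Reachable.subset {i : ℕ} {A : Finset ℕ} (h : Reachable adj k i A) : A ⊆ range i := by
  induction h with
  | empty => exact empty_subset _
  | grow A u _ hu _ _ ih => exact insert_subset (mem_range.2 hu) ih

theorem reachable_iff {i : ℕ} {A : Finset ℕ} (hA : A ⊆ range i) :
    Reachable adj k i A ↔
      (backArcs adj i A).card ≤ k ∧ (A = ∅ ∨ ∃ u ∈ A, Reachable adj k i (A.erase u)) := by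
  constructor
  · intro h
    refine ⟨h.card_le, ?_⟩
    cases h with
    | empty => exact .inl rfl
    | grow A u h _ hu _ =>
      exact .inr ⟨u, mem_insert_self _ _, by rwa [erase_insert hu]⟩
  · rintro ⟨h, rfl | ⟨u, hu, hr⟩⟩
    · exact .empty
    · have := hr.grow _ u (mem_range.1 (hA hu)) (notMem_erase u A)
      rw [insert_erase hu] at this
      exact this h

theorem Reachable.erase_last {i : ℕ} {A : Finset ℕ} (h : Reachable adj k (i + 1) A) :
    Reachable adj k i (A.erase i) := by
  induction h with
  | empty => rw [erase_eq_of_notMem (notMem_empty _)]; exact .empty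
  | grow A u _ hu hA hc ih =>
    rcases eq_or_ne u i with rfl | hne
    · rwa [erase_insert_eq_erase]
    · rw [erase_insert_of_ne hne]
      refine ih.grow _ u (by omega) (fun h => hA (mem_of_mem_erase h)) ?_
      refine (card_le_card fun e he => ?_).trans hc
      simp only [mem_backArcs, mem_insert, mem_erase] at he ⊢
      obtain ⟨⟨h1, h2⟩, h3, h4, h5⟩ := he
      refine ⟨by omega, h3, fun h => h4 ?_, ?_⟩
      · exact h.imp_right fun h => ⟨by omega, h⟩
      · exact h5.imp_right fun h => h.2

theorem Reachable.range_mono {i j : ℕ} (hij : i ≤ j) (h : Reachable adj k j (range j)) :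
    Reachable adj k i (range i) := by
  induction hij with
  | refl => exact h
  | step _ ih =>
    refine ih ?_
    have := h.erase_last
    rwa [range_add_one, erase_insert notMem_range_self] at this

theorem Reachable.exists_order {i : ℕ} {A : Finset ℕ} (h : Reachable adj k i A) :
    ∃ e : ℕ → ℕ, Set.InjOn e (range A.card) ∧ (range A.card).image e = A ∧
      ∀ p ≤ A.card, (backArcs adj i ((range p).image e)).card ≤ k := by
  induction h with
  | empty =>
    refine ⟨id, by simp, by simp, ?_⟩
    intro p hp
    obtain rfl : p = 0 := by simpa using hp
    simp [backArcs_empty]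
  | grow A u _ hu hA hc ih =>
    obtain ⟨e, hinj, him, hw⟩ := ih
    have hagree : ∀ p ≤ A.card, (range p).image (Function.update e A.card u) =
        (range p).image e := fun p hp => image_congr fun q hq => by
      rw [Function.update_of_ne]
      have := mem_range.1 (mem_coe.1 hq)
      omega
    have hlast : (range (A.card + 1)).image (Function.update e A.card u) = insert u A := by
      rw [range_add_one, image_insert, Function.update_self, hagree _ le_rfl, him]
    rw [card_insert_of_notMem hA]
    refine ⟨Function.update e A.card u, ?_, hlast, fun p hp => ?_⟩
    · rw [← card_image_iff, hlast, card_range, card_insert_of_notMem hA]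
    · rcases Nat.lt_or_ge A.card p with h | h
      · obtain rfl : p = A.card + 1 := by omega
        rwa [hlast]
      · rw [hagree p h]
        exact hw p h

theorem card_sdiff_mul_card_sdiff_le {i : ℕ}
    (hadj : ∀ x < i, ∀ y < i, x ≠ y → adj x y ∨ adj y x) {A P : Finset ℕ}
    (hA : A ⊆ range i) (hP : P ⊆ range i) (hAk : (backArcs adj i A).card ≤ k)
    (hPk : (backArcs adj i P).card ≤ k) : (P \ A).card * (A \ P).card ≤ 2 * k := by
  rw [← card_product]
  have h : (P \ A) ×ˢ (A \ P) ⊆ backArcs adj i A ∪ (backArcs adj i P).image Prod.swap := by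
    rintro ⟨x, y⟩ he
    simp only [mem_product, mem_sdiff] at he
    obtain ⟨⟨hxP, hxA⟩, hyA, hyP⟩ := he
    have hx := mem_range.1 (hP hxP)
    have hy := mem_range.1 (hA hyA)
    simp only [mem_union, mem_image, mem_backArcs, Prod.exists, Prod.swap_prod_mk, Prod.mk.injEq]
    rcases hadj x hx y hy (by rintro rfl; exact hxA hyA) with h | h
    · exact .inl ⟨⟨hx, hy⟩, h, hxA, hyA⟩
    · exact .inr ⟨y, x, ⟨⟨hy, hx⟩, h, hyP, hxP⟩, rfl, rfl⟩
  calc _ ≤ _ := card_le_card h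
    _ ≤ _ := card_union_le _ _
    _ ≤ k + k := add_le_add hAk (card_image_le.trans hPk)
    _ = 2 * k := (two_mul k).symm

/-- The elements missing from the first `t` numbers, counted downwards from `t`. -/
def gapsBelow (t : ℕ) (Q : Finset ℕ) : Finset ℕ := (range t).filter fun d => t - 1 - d ∉ Q

/-- The elements of `Q` from `t` on, counted upwards from `t`. -/
def excessAbove (i t : ℕ) (Q : Finset ℕ) : Finset ℕ := (range i).filter fun d => d + t ∈ Q

theorem eq_of_gapsBelow_eq_of_excessAbove_eq {i t : ℕ} {Q Q' : Finset ℕ} (hQ : Q ⊆ range i)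
    (hQ' : Q' ⊆ range i) (h : gapsBelow t Q = gapsBelow t Q')
    (h' : excessAbove i t Q = excessAbove i t Q') : Q = Q' := by
  ext q
  rcases Nat.lt_or_ge q t with hq | hq
  · have := Finset.ext_iff.1 h (t - 1 - q)
    simp only [gapsBelow, mem_filter, mem_range] at this
    rw [show t - 1 - (t - 1 - q) = q by omega] at this
    have h2 : t - 1 - q < t := by omega
    tauto
  · have := Finset.ext_iff.1 h' (q - t)
    simp only [excessAbove, mem_filter, mem_range] at this
    rw [show q - t + t = q by omega] at this
    have h2 : q ∈ Q → q - t < i := fun h => by have := mem_range.1 (hQ h); omega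
    have h3 : q ∈ Q' → q - t < i := fun h => by have := mem_range.1 (hQ' h); omega
    tauto

theorem card_filter_le_add_card_filter_lt (Q : Finset ℕ) (p : ℕ) :
    Q.card ≤ p + (Q.filter fun q => p ≤ q).card := by
  have h : Q ⊆ range p ∪ Q.filter fun q => p ≤ q := fun q hq => by
    simp only [mem_union, mem_range, mem_filter, hq, true_and]
    omega
  have h2 := (card_le_card h).trans (card_union_le _ _)
  rwa [card_range] at h2

theorem le_card_add_card_range_sdiff (Q : Finset ℕ) (p : ℕ) :
    p ≤ Q.card + (range p \ Q).card := by
  have h : range p ⊆ Q ∪ (range p \ Q) := fun q hq => by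
    simp only [mem_union, mem_sdiff, hq, true_and]
    tauto
  have h2 := (card_le_card h).trans (card_union_le _ _)
  rwa [card_range] at h2

theorem isNarrow_gapsBelow {K i : ℕ} {Q : Finset ℕ} (hQi : Q ⊆ range i)
    (hQ : ∀ p ≤ i, (range p \ Q).card * (Q.filter fun q => p ≤ q).card ≤ K) :
    IsNarrow K (gapsBelow Q.card Q) := by
  intro x
  have hci : Q.card ≤ i := by simpa using card_le_card hQi
  rcases Nat.lt_or_ge x Q.card with hx | hx
  · refine le_trans (Nat.mul_le_mul ?_ ?_) (hQ (Q.card - x) (by omega))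
    · refine card_le_card_of_injOn (fun d => Q.card - 1 - d) ?_ ?_
      · intro d hd
        simp only [gapsBelow, coe_filter, mem_filter, mem_range, Set.mem_ofPred_eq] at hd
        simp only [coe_sdiff, Set.mem_sdiff, mem_coe, mem_range]
        exact ⟨by omega, hd.1.2⟩
      · intro d hd d' hd' hdd
        simp only [gapsBelow, coe_filter, mem_filter, mem_range, Set.mem_ofPred_eq] at hd hd' hdd
        omega
    · have := card_filter_le_add_card_filter_lt Q (Q.card - x)
      omega
  · have : ((gapsBelow Q.card Q).filter fun d => x ≤ d) = ∅ := by
      ext d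
      simp only [gapsBelow, mem_filter, mem_range, notMem_empty, iff_false]
      omega
    simp [this]

theorem isNarrow_excessAbove {K i : ℕ} {Q : Finset ℕ} (hQi : Q ⊆ range i)
    (hQ : ∀ p ≤ i, (range p \ Q).card * (Q.filter fun q => p ≤ q).card ≤ K) :
    IsNarrow K (excessAbove i Q.card Q) := by
  intro x
  rcases Nat.lt_or_ge i (Q.card + x) with hx | hx
  · have : ((excessAbove i Q.card Q).filter fun d => x ≤ d) = ∅ := by
      ext d
      simp only [excessAbove, mem_filter, notMem_empty, iff_false]
      rintro ⟨⟨_, h⟩, h'⟩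
      have := mem_range.1 (hQi h)
      omega
    simp [this]
  · rw [mul_comm]
    refine le_trans (Nat.mul_le_mul ?_ ?_) (hQ (Q.card + x) hx)
    · have := le_card_add_card_range_sdiff Q (Q.card + x)
      omega
    · refine card_le_card_of_injOn (fun d => d + Q.card) ?_ ?_
      · intro d hd
        simp only [excessAbove, coe_filter, mem_filter, mem_range, Set.mem_ofPred_eq] at hd
        simp only [coe_filter, Set.mem_ofPred_eq]
        exact ⟨hd.1.2, by omega⟩
      · intro d _ d' _ hdd
        simpa using hdd

open Classical in
theorem card_reachable_le {i : ℕ} (hadj : ∀ x < i, ∀ y < i, x ≠ y → adj x y ∨ adj y x)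
    (hr : Reachable adj k i (range i)) :
    (((range i).powerset.filter (Reachable adj k i)).card : ℝ) ≤
      (i + 1) * Real.exp (2 * narrowScale (2 * k) + 1) ^ 2 := by
  obtain ⟨e, hinj, him, hw⟩ := hr.exists_order
  rw [card_range] at hinj him hw
  set F := (range i).powerset.filter (IsNarrow (2 * k)) with hF
  have hFcard := card_narrow_le (2 * k) F fun D hD => (mem_filter.1 hD).2
  let pos : Finset ℕ → Finset ℕ := fun A => (range i).filter fun q => e q ∈ A
  have hpos_sub : ∀ A, pos A ⊆ range i := fun A => filter_subset _ _
  have hpos_image : ∀ A ⊆ range i, (pos A).image e = A := by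
    intro A hA
    ext y
    simp only [pos, mem_image, mem_filter]
    constructor
    · rintro ⟨q, ⟨_, hq⟩, rfl⟩; exact hq
    · intro hy
      have := hA hy
      rw [← him, mem_image] at this
      obtain ⟨q, hq, rfl⟩ := this
      exact ⟨q, ⟨hq, hy⟩, rfl⟩
  have hprofile : ∀ A ∈ (range i).powerset.filter (Reachable adj k i), ∀ p ≤ i,
      (range p \ pos A).card * ((pos A).filter fun q => p ≤ q).card ≤ 2 * k := by
    intro A hA p hp
    obtain ⟨hA, hAr⟩ := mem_filter.1 hA
    rw [mem_powerset] at hA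
    have hpi : range p ⊆ range i := range_subset_range.2 hp
    have hP : (range p).image e ⊆ range i := by
      rw [← him]; exact image_subset_image hpi
    refine le_trans (Nat.mul_le_mul ?_ ?_)
      (card_sdiff_mul_card_sdiff_le hadj hA hP hAr.card_le (hw p hp))
    · refine card_le_card_of_injOn e ?_ (hinj.mono ?_)
      · intro q hq
        simp only [pos, coe_sdiff, Set.mem_sdiff, mem_coe, mem_range, mem_filter] at hq
        simp only [coe_sdiff, Set.mem_sdiff, mem_coe]
        exact ⟨mem_image_of_mem _ (mem_range.2 hq.1), fun h => hq.2 ⟨by omega, h⟩⟩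
      · exact coe_subset.2 (sdiff_subset.trans hpi)
    · refine card_le_card_of_injOn e ?_ (hinj.mono ?_)
      · intro q hq
        simp only [pos, coe_filter, mem_filter, mem_range, Set.mem_ofPred_eq] at hq
        simp only [coe_sdiff, Set.mem_sdiff, mem_coe, mem_image, mem_range, not_exists, not_and]
        refine ⟨hq.1.2, fun q' hq' hqq => ?_⟩
        have := hinj (mem_coe.2 (mem_range.2 (by omega))) (mem_coe.2 (mem_range.2 hq.1.1)) hqq
        omega
      · exact coe_subset.2 ((filter_subset _ _).trans (hpos_sub A))
  have hcard : ((range i).powerset.filter (Reachable adj k i)).card ≤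
      (range (i + 1) ×ˢ (F ×ˢ F)).card := by
    refine card_le_card_of_injOn
      (fun A => ((pos A).card, gapsBelow (pos A).card (pos A), excessAbove i (pos A).card (pos A)))
      ?_ ?_
    · intro A hA
      have hci : (pos A).card ≤ i := by simpa using card_le_card (hpos_sub A)
      have hprof := hprofile A hA
      simp only [coe_product, Set.mem_prod, mem_coe, mem_range, hF, mem_filter, mem_powerset]
      refine ⟨by omega, ⟨?_, isNarrow_gapsBelow (hpos_sub A) hprof⟩,
        ?_, isNarrow_excessAbove (hpos_sub A) hprof⟩
      · exact (filter_subset _ _).trans (range_subset_range.2 hci)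
      · exact filter_subset _ _
    · intro A hA A' hA' h
      simp only [Prod.mk.injEq] at h
      obtain ⟨h1, h2, h3⟩ := h
      rw [h1] at h2 h3
      have := eq_of_gapsBelow_eq_of_excessAbove_eq (hpos_sub A) (hpos_sub A') h2 h3
      rw [← hpos_image A (mem_powerset.1 (mem_filter.1 hA).1), this,
        hpos_image A' (mem_powerset.1 (mem_filter.1 hA').1)]
  rw [card_product, card_product, card_range] at hcard
  calc _ ≤ ((((i + 1) * (F.card * F.card) : ℕ)) : ℝ) := by exact_mod_cast hcard
    _ = (i + 1) * (F.card : ℝ) ^ 2 := by push_cast; ring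
    _ ≤ _ := by gcongr

end Reachable

/-! ## Sets of numbers as binary codes -/

section SetCode

open Finset

/-- The number whose binary digits are the indicator of `A`. -/
def setCode (A : Finset ℕ) : ℕ := ∑ u ∈ A, 2 ^ u

theorem setCode_injective : Function.Injective setCode := fun A B h => by
  rw [← Finset.toFinset_bitIndices_sum_two_pow A, ← Finset.toFinset_bitIndices_sum_two_pow B]
  exact congrArg (fun c => c.bitIndices.toFinset) h

theorem setCode_empty : setCode ∅ = 0 := rfl

theorem setCode_erase {A : Finset ℕ} {u : ℕ} (h : u ∈ A) :
    setCode (A.erase u) = setCode A - 2 ^ u := by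
  rw [setCode, setCode, ← sum_erase_add _ _ h, Nat.add_sub_cancel]

theorem setCode_insert {A : Finset ℕ} {u : ℕ} (h : u ∉ A) :
    setCode (insert u A) = setCode A + 2 ^ u := by
  rw [setCode, setCode, sum_insert h, add_comm]

theorem setCode_range (i : ℕ) : setCode (range i) = 2 ^ i - 1 := by
  induction i with
  | zero => rfl
  | succ i ih =>
    rw [range_add_one, setCode_insert notMem_range_self, ih, pow_succ]
    have := Nat.one_le_two_pow (n := i)
    omega

theorem setCode_lt {A : Finset ℕ} {i : ℕ} (h : A ⊆ range i) : setCode A < 2 ^ i := by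
  have h1 : setCode A ≤ setCode (range i) := sum_le_sum_of_subset h
  rw [setCode_range] at h1
  have := Nat.one_le_two_pow (n := i)
  omega

theorem setCode_eq_zero {A : Finset ℕ} : setCode A = 0 ↔ A = ∅ :=
  ⟨fun h => setCode_injective h, fun h => h ▸ rfl⟩

theorem setCode_filter_succ (A : Finset ℕ) (u : ℕ) :
    setCode (A.filter (· < u + 1)) =
      setCode (A.filter (· < u)) + if u ∈ A then 2 ^ u else 0 := by
  split_ifs with h
  · rw [← setCode_insert (by simp)]
    congr 1
    ext x
    simp only [mem_filter, mem_insert]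
    constructor
    · intro hx
      rcases eq_or_ne x u with h' | h'
      · exact .inl h'
      · exact .inr ⟨hx.1, by omega⟩
    · rintro (rfl | hx)
      · exact ⟨h, by omega⟩
      · exact ⟨hx.1, by omega⟩
  · rw [add_zero]
    congr 1
    ext x
    simp only [mem_filter]
    refine and_congr_right fun hx => ?_
    have : x ≠ u := by rintro rfl; exact h hx
    omega

theorem setCode_filter_lt (A : Finset ℕ) (u : ℕ) : setCode (A.filter (· < u)) < 2 ^ u :=
  setCode_lt fun _ hx => mem_range.2 (mem_filter.1 hx).2

end SetCode

/-! ## The program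

The following names are used for the arrays of the store, those of registers starting with `r`. -/

namespace RAM

notation "rN" => (0 : Fin 22)
notation "rK" => (1 : Fin 22)
notation "rI" => (2 : Fin 22)
notation "rLo" => (3 : Fin 22)
notation "rHi" => (4 : Fin 22)
notation "rEnd" => (5 : Fin 22)
notation "rPtr" => (6 : Fin 22)
notation "rCode" => (7 : Fin 22)
notation "rRem" => (8 : Fin 22)
notation "rU" => (9 : Fin 22)
notation "rW" => (10 : Fin 22)
notation "rAcc" => (11 : Fin 22)
notation "rFlag" => (12 : Fin 22)
notation "rAlive" => (13 : Fin 22)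
notation "rCnt" => (14 : Fin 22)
notation "aAdj" => (15 : Fin 22)
notation "aRow" => (16 : Fin 22)
notation "aPow" => (17 : Fin 22)
notation "aBit" => (18 : Fin 22)
notation "aList" => (19 : Fin 22)
notation "aMark" => (20 : Fin 22)
notation "aLast" => (21 : Fin 22)

theorem Store.set_apply (v : Store) (j j' : Fin 22) (x x' y : ℕ) :
    v.set j x y j' x' = if j' = j ∧ x' = x then y else v j' x' := rfl

theorem Store.set_of_ne (v : Store) {j j' : Fin 22} (x y : ℕ) (h : j' ≠ j) :
    v.set j x y j' = v j' := by
  funext x'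
  simp [Store.set_apply, h]

/-- The stores agree outside the arrays in `l`. -/
def AgreeOff (l : List (Fin 22)) (v v' : Store) : Prop := ∀ j, j ∉ l → v' j = v j

theorem AgreeOff.refl (l : List (Fin 22)) (v : Store) : AgreeOff l v v := fun _ _ => rfl

theorem AgreeOff.trans {l : List (Fin 22)} {v v' v'' : Store} (h : AgreeOff l v v')
    (h' : AgreeOff l v' v'') : AgreeOff l v v'' := fun j hj => (h' j hj).trans (h j hj)

theorem AgreeOff.mono {l l' : List (Fin 22)} {v v' : Store} (h : AgreeOff l v v')
    (hl : l ⊆ l') : AgreeOff l' v v' := fun j hj => h j fun hj' => hj (hl hj')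

theorem AgreeOff.set {l : List (Fin 22)} {v v' : Store} (h : AgreeOff l v v') {j : Fin 22}
    (hj : j ∈ l) (x y : ℕ) : AgreeOff l v (v'.set j x y) := fun j' hj' => by
  have hne : j' ≠ j := by rintro rfl; exact hj' hj
  rw [Store.set_of_ne _ _ _ hne, h j' hj']

theorem add_mul_le_add_mul {a b m : ℕ} (hm : 1 ≤ m) : a + m * b ≤ (a + b) * m := by
  rw [Nat.add_mul, mul_comm m b]
  exact Nat.add_le_add_right (Nat.le_mul_of_pos_right _ hm) _

/-- The content of a register. -/
abbrev SExpr.reg (j : Fin 22) : SExpr := .rd j (.const 0)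

/-- Assignment to a register. -/
abbrev Block.setReg (j : Fin 22) (e : SExpr) : Block := .wr j (.const 0) e

open SExpr Block in
/-- One binary digit of the remainder. -/
def decodeStep : Block :=
  .seq (setReg rU (sub (reg rU) (.const 1)))
    (.ite (sub (add (reg rRem) (.const 1)) (rd aPow (reg rU)))
      (.seq (wr aBit (reg rU) (.const 1)) (setReg rRem (sub (reg rRem) (rd aPow (reg rU)))))
      (wr aBit (reg rU) (.const 0)))

open SExpr Block in
/-- The initialization of `decode`. -/
def decodeInit : Block :=
  .seq (setReg rRem (reg rCode)) (setReg rU (add (reg rI) (.const 1)))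

/-- Write the binary digits of the code into the array of bits. -/
def decode : Program :=
  .seq decodeInit.compile (.loop (SExpr.reg rU).compile decodeStep.compile)

theorem exists_exec_decode : ∃ C, ∀ (v : Store) (i : ℕ) (A : Finset ℕ), A ⊆ Finset.range (i + 1) →
    v rI 0 = i → (∀ u ≤ i, v aPow u = 2 ^ u) → v rCode 0 = setCode A →
    ∃ v', Exec decode v (C * (i + 2)) v' ∧ AgreeOff [rRem, rU, aBit] v v' ∧
      ∀ u ≤ i, v' aBit u = if u ∈ A then 1 else 0 := by
  refine ⟨decodeInit.time + (decodeStep.time + (SExpr.reg rU).compile.cost + 1),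
    fun v i A hA hi hpow hcode => ?_⟩
  have h1 := decodeInit.exec v
  refine (Exec.loop_of_invariant (e := SExpr.reg rU)
    (p := decodeStep.compile) (t := decodeStep.time) (i + 1)
    (fun q w => AgreeOff [rRem, rU, aBit] v w ∧ w rU 0 = i + 1 - q ∧
      w rRem 0 = setCode (A.filter (· < i + 1 - q)) ∧
      ∀ u ≤ i, i + 1 - q ≤ u → w aBit u = if u ∈ A then 1 else 0)
    (v := decodeInit.run v) ?_ ?_ ?_).elim ?_
  rotate_left 3
  · rintro v' ⟨h2, ha, -, -, hb⟩
    refine ⟨v', (h1.seq h2).mono ?_, ha, fun u hu => hb u hu (by omega)⟩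
    exact add_mul_le_add_mul (by omega)
  · refine ⟨((AgreeOff.refl _ _).set (by simp) _ _).set (by simp) _ _, ?_, ?_, ?_⟩
    · simp [decodeInit, Block.run, SExpr.eval, Store.set_apply, hi]
    · simp only [decodeInit, Block.run, SExpr.eval, Store.set_apply]
      simp [hcode]
      congr 1
      rw [eq_comm, Finset.filter_eq_self]
      exact fun x hx => by have := Finset.mem_range.1 (hA hx); omega
    · intro u hu hu'
      omega
  · rintro q hq w ⟨ha, hU, hR, hB⟩
    refine ⟨by simp [SExpr.eval, hU]; omega, _, decodeStep.exec w, ?_⟩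
    obtain ⟨u, hu⟩ : ∃ u, i + 1 - q = u + 1 := ⟨i - q, by omega⟩
    have hu' : i + 1 - (q + 1) = u := by omega
    have hpw : w aPow u = 2 ^ u := by rw [ha aPow (by simp)]; exact hpow u (by omega)
    have hlt := setCode_filter_lt A u
    rw [hu, setCode_filter_succ] at hR
    rw [hu] at hU hB
    rw [hu']
    by_cases huA : u ∈ A
    · have hrun : decodeStep.run w =
          ((w.set rU 0 u).set aBit u 1).set rRem 0 (setCode (A.filter (· < u))) := by
        simp [decodeStep, Block.run, SExpr.eval, Store.set_apply, hU, hR, hpw, huA]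
        intro h; omega
      rw [hrun]
      refine ⟨((ha.set (by simp) _ _).set (by simp) _ _).set (by simp) _ _, ?_, ?_, ?_⟩
      · simp [Store.set_apply]
      · simp [Store.set_apply]
      · intro x hx hux
        by_cases hxu : x = u
        · simp [Store.set_apply, hxu, huA]
        · simp only [Store.set_apply, hxu]
          simpa using hB x hx (by omega)
    · have hrun : decodeStep.run w = (w.set rU 0 u).set aBit u 0 := by
        simp [decodeStep, Block.run, SExpr.eval, Store.set_apply, hU, hR, hpw, huA]
        intro h; omega
      rw [hrun]
      refine ⟨(ha.set (by simp) _ _).set (by simp) _ _, ?_, ?_, ?_⟩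
      · simp [Store.set_apply]
      · simpa [Store.set_apply, huA] using hR
      · intro x hx hux
        by_cases hxu : x = u
        · simp [Store.set_apply, hxu, huA]
        · simp only [Store.set_apply, hxu]
          simpa using hB x hx (by omega)
  · rintro w ⟨-, hU, -⟩
    simp [SExpr.eval, hU]

open SExpr Block in
/-- Count the arc from the vertex in `rU` to the vertex in `rW` if it is a back arc. -/
def countInnerStep : Block :=
  .seq (setReg rAcc (add (reg rAcc) (sub
      (add (rd aAdj (add (rd aRow (reg rU)) (reg rW))) (rd aBit (reg rW)))
      (add (.const 1) (rd aBit (reg rU))))))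
    (setReg rW (add (reg rW) (.const 1)))

/-- The vertex in register `j` is at most the one in `rI`. -/
abbrev SExpr.inRange (j : Fin 22) : SExpr := .sub (.add (.reg rI) (.const 1)) (.reg j)

/-- Count the back arcs from the vertex in `rU`. -/
def countInner : Program :=
  .seq (Block.setReg rW (.const 0)).compile
    (.loop (SExpr.inRange rW).compile countInnerStep.compile)

/-- Proceed to the next vertex. -/
abbrev incrU : Block := .setReg rU (.add (.reg rU) (.const 1))

/-- The initialization of `countArcs`. -/
abbrev countInit : Block := .seq (.setReg rAcc (.const 0)) (.setReg rU (.const 0))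

/-- Count the back arcs of the set given by the array of bits. -/
def countArcs : Program :=
  .seq countInit.compile
    (.loop (SExpr.inRange rU).compile (.seq countInner incrU.compile))

/-- The contribution of a pair of vertices to the count. -/
def Store.backArc (v : Store) (u w : ℕ) : ℕ :=
  v aAdj (v aRow u + w) + v aBit w - (1 + v aBit u)

theorem AgreeOff.backArc {l : List (Fin 22)} {v v' : Store} (h : AgreeOff l v v')
    (h1 : aAdj ∉ l) (h2 : aRow ∉ l) (h3 : aBit ∉ l) : v'.backArc = v.backArc := by
  funext u w
  simp only [Store.backArc, h _ h1, h _ h2, h _ h3]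

theorem exists_exec_countInner : ∃ C, ∀ (v : Store) (i : ℕ), v rI 0 = i →
    ∃ v', Exec countInner v (C * (i + 2)) v' ∧ AgreeOff [rAcc, rW] v v' ∧
      v' rAcc 0 = v rAcc 0 + ∑ w ∈ Finset.range (i + 1), v.backArc (v rU 0) w := by
  refine ⟨(Block.setReg rW (.const 0)).time +
    (countInnerStep.time + (SExpr.inRange rW).compile.cost + 1), fun v i hi => ?_⟩
  have h1 := (Block.setReg rW (.const 0)).exec v
  refine (Exec.loop_of_invariant (e := SExpr.inRange rW)
    (p := countInnerStep.compile) (t := countInnerStep.time) (i + 1)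
    (fun q w => AgreeOff [rAcc, rW] v w ∧ w rW 0 = q ∧
      w rAcc 0 = v rAcc 0 + ∑ x ∈ Finset.range q, v.backArc (v rU 0) x)
    (v := (Block.setReg rW (.const 0)).run v) ?_ ?_ ?_).elim ?_
  rotate_left 3
  · rintro v' ⟨h2, ha, -, hacc⟩
    exact ⟨v', (h1.seq h2).mono (add_mul_le_add_mul (by omega)), ha, hacc⟩
  · exact ⟨(AgreeOff.refl _ _).set (by simp) _ _, by simp [Block.run, SExpr.eval, Store.set_apply],
      by simp [Block.run, SExpr.eval, Store.set_apply]⟩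
  · rintro q hq w ⟨ha, hW, hacc⟩
    have hI : w rI 0 = i := by rw [ha rI (by simp), hi]
    have hU : w rU 0 = v rU 0 := by rw [ha rU (by simp)]
    refine ⟨by simp [SExpr.eval, hI, hW]; omega, _, countInnerStep.exec w,
      (ha.set (by simp) _ _).set (by simp) _ _, ?_, ?_⟩
    · simp [countInnerStep, Block.run, SExpr.eval, Store.set_apply, hW]
    · rw [Finset.sum_range_succ, ← add_assoc, ← hacc, ← ha.backArc (by simp) (by simp) (by simp)]
      simp [countInnerStep, Block.run, SExpr.eval, Store.set_apply, hW, hU, Store.backArc]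
  · rintro w ⟨ha, hW, -⟩
    have hI : w rI 0 = i := by rw [ha rI (by simp), hi]
    simp [SExpr.eval, hI, hW]

theorem exists_exec_countArcs : ∃ C, ∀ (v : Store) (i : ℕ), v rI 0 = i →
    ∃ v', Exec countArcs v (C * (i + 2) ^ 2) v' ∧ AgreeOff [rAcc, rU, rW] v v' ∧
      v' rAcc 0 = ∑ u ∈ Finset.range (i + 1), ∑ w ∈ Finset.range (i + 1), v.backArc u w := by
  obtain ⟨C, hC⟩ := exists_exec_countInner
  refine ⟨countInit.time + (C + incrU.time + (SExpr.inRange rU).compile.cost + 1),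
    fun v i hi => ?_⟩
  have h1 := countInit.exec v
  refine (Exec.loop_of_invariant (e := SExpr.inRange rU)
    (p := .seq countInner incrU.compile) (t := C * (i + 2) + incrU.time) (i + 1)
    (fun q w => AgreeOff [rAcc, rU, rW] v w ∧ w rU 0 = q ∧
      w rAcc 0 = ∑ u ∈ Finset.range q, ∑ x ∈ Finset.range (i + 1), v.backArc u x)
    (v := countInit.run v) ?_ ?_ ?_).elim ?_
  rotate_left 3
  · rintro v' ⟨h2, ha, -, hacc⟩
    refine ⟨v', (h1.seq h2).mono ?_, ha, hacc⟩
    generalize countInit.time = a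
    generalize incrU.time = b
    generalize (SExpr.inRange rU).compile.cost = d
    nlinarith [Nat.zero_le (i * i), Nat.zero_le (a * i), Nat.zero_le (b * i), Nat.zero_le (d * i),
      Nat.zero_le (a * i * i), Nat.zero_le (b * i * i), Nat.zero_le (d * i * i)]
  · exact ⟨((AgreeOff.refl _ _).set (by simp) _ _).set (by simp) _ _,
      by simp [Block.run, SExpr.eval, Store.set_apply],
      by simp [Block.run, SExpr.eval, Store.set_apply]⟩
  · rintro q hq w ⟨ha, hU, hacc⟩
    have hI : w rI 0 = i := by rw [ha rI (by simp), hi]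
    obtain ⟨w', hx, ha', hacc'⟩ := hC w i hI
    have hU' : w' rU 0 = q := by rw [ha' rU (by simp), hU]
    refine ⟨by simp [SExpr.eval, hI, hU]; omega, _, hx.seq (incrU.exec w'),
      (ha.trans (ha'.mono (by simp))).set (by simp) _ _, ?_, ?_⟩
    · simp [Block.run, SExpr.eval, Store.set_apply, hU']
    · rw [Finset.sum_range_succ, ← hacc, ← ha.backArc (by simp) (by simp) (by simp), ← hU, ← hacc']
      simp [Block.run, SExpr.eval, Store.set_apply]
  · rintro w ⟨ha, hU, -⟩
    have hI : w rI 0 = i := by rw [ha rI (by simp), hi]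
    simp [SExpr.eval, hI, hU]

open SExpr Block in
/-- Test whether the set without the vertex in `rU` is marked. -/
def searchStep : Block :=
  .seq (.ite (rd aBit (reg rU))
      (.ite (sub (rd aMark (sub (reg rCode) (rd aPow (reg rU)))) (reg rI))
        (.seq (setReg rFlag (.const 1)) (wr aLast (reg rCode) (reg rU))) .skip) .skip) incrU

/-- The initialization of `search`. -/
abbrev searchInit : Block :=
  .seq (.setReg rFlag (.sub (.const 1) (.reg rCode))) (.setReg rU (.const 0))

/-- Search for a vertex whose removal gives a marked set. -/
def search : Program :=
  .seq searchInit.compile (.loop (SExpr.inRange rU).compile searchStep.compile)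

/-- The vertex `u` belongs to the current set, and its removal gives a marked set. -/
def Store.IsLast (v : Store) (u : ℕ) : Prop :=
  v aBit u ≠ 0 ∧ v rI 0 < v aMark (v rCode 0 - v aPow u)

theorem AgreeOff.isLast {l : List (Fin 22)} {v v' : Store} (h : AgreeOff l v v')
    (h1 : aBit ∉ l) (h2 : rI ∉ l) (h3 : aMark ∉ l) (h4 : rCode ∉ l) (h5 : aPow ∉ l) :
    v'.IsLast = v.IsLast := by
  funext u
  simp only [Store.IsLast, h _ h1, h _ h2, h _ h3, h _ h4, h _ h5]

theorem exists_exec_search : ∃ C, ∀ (v : Store) (i : ℕ), v rI 0 = i →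
    ∃ v', Exec search v (C * (i + 2)) v' ∧ AgreeOff [rFlag, rU, aLast] v v' ∧
      (∀ x ≠ v rCode 0, v' aLast x = v aLast x) ∧
      (v' rFlag 0 ≠ 0 ↔ v rCode 0 = 0 ∨ ∃ u < i + 1, v.IsLast u) ∧
      ((∃ u < i + 1, v.IsLast u) →
        v' aLast (v rCode 0) < i + 1 ∧ v.IsLast (v' aLast (v rCode 0))) := by
  refine ⟨searchInit.time + (searchStep.time + (SExpr.inRange rU).compile.cost + 1),
    fun v i hi => ?_⟩
  have h1 := searchInit.exec v
  refine (Exec.loop_of_invariant (e := SExpr.inRange rU)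
    (p := searchStep.compile) (t := searchStep.time) (i + 1)
    (fun q w => AgreeOff [rFlag, rU, aLast] v w ∧ w rU 0 = q ∧
      (∀ x ≠ v rCode 0, w aLast x = v aLast x) ∧
      (w rFlag 0 ≠ 0 ↔ v rCode 0 = 0 ∨ ∃ u < q, v.IsLast u) ∧
      ((∃ u < q, v.IsLast u) → w aLast (v rCode 0) < q ∧ v.IsLast (w aLast (v rCode 0))))
    (v := searchInit.run v) ?_ ?_ ?_).elim ?_
  rotate_left 3
  · rintro v' ⟨h2, ha, -, h⟩
    exact ⟨v', (h1.seq h2).mono (add_mul_le_add_mul (by omega)), ha, h⟩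
  · refine ⟨((AgreeOff.refl _ _).set (by simp) _ _).set (by simp) _ _, ?_, ?_, ?_, ?_⟩
    · simp [Block.run, SExpr.eval, Store.set_apply]
    · simp [Block.run, SExpr.eval, Store.set_apply]
    · simp [Block.run, SExpr.eval, Store.set_apply]
      omega
    · simp
  · rintro q hq w ⟨ha, hU, hoff, hflag, hlast⟩
    have hI : w rI 0 = i := by rw [ha rI (by simp), hi]
    have hcode : w rCode = v rCode := ha _ (by simp)
    refine ⟨by simp [SExpr.eval, hI, hU]; omega, _, searchStep.exec w, ?_⟩
    have hiff : w.IsLast q ↔ v.IsLast q := by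
      rw [ha.isLast (by simp) (by simp) (by simp) (by simp) (by simp)]
    by_cases hq' : w.IsLast q
    · have hrun : searchStep.run w =
          ((w.set rFlag 0 1).set aLast (v rCode 0) q).set rU 0 (q + 1) := by
        obtain ⟨h2, h3⟩ := hq'
        rw [hcode] at h3
        simp [searchStep, Block.run, SExpr.eval, Store.set_apply, hU, h2, Nat.sub_ne_zero_of_lt h3,
          hcode]
      rw [hrun]
      refine ⟨((ha.set (by simp) _ _).set (by simp) _ _).set (by simp) _ _, ?_, ?_, ?_, ?_⟩
      · simp [Store.set_apply]
      · intro x hx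
        simpa [Store.set_apply, hx] using hoff x hx
      · simp only [Store.set_apply]
        simpa using .inr ⟨q, by omega, hiff.1 hq'⟩
      · intro _
        simpa [Store.set_apply] using hiff.1 hq'
    · have hrun : searchStep.run w = w.set rU 0 (q + 1) := by
        by_cases h2 : w aBit q = 0
        · simp [searchStep, Block.run, SExpr.eval, hU, h2]
        · have h3 : w aMark (v rCode 0 - w aPow q) - w rI 0 = 0 := by
            rw [← hcode]
            exact Nat.sub_eq_zero_of_le (not_lt.1 fun h => hq' ⟨h2, h⟩)
          simp [searchStep, Block.run, SExpr.eval, hU, h2, h3, hcode]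
      rw [hrun]
      have hex : (∃ u < q + 1, v.IsLast u) ↔ ∃ u < q, v.IsLast u := by
        constructor
        · rintro ⟨u, hu, h⟩
          refine ⟨u, ?_, h⟩
          have : u ≠ q := by rintro rfl; exact hq' (hiff.2 h)
          omega
        · rintro ⟨u, hu, h⟩
          exact ⟨u, by omega, h⟩
      refine ⟨ha.set (by simp) _ _, ?_, ?_, ?_, ?_⟩
      · simp [Store.set_apply]
      · simpa [Store.set_apply] using hoff
      · rw [hex, ← hflag]
        simp [Store.set_apply]
      · rw [hex]
        intro h
        obtain ⟨h1, h2⟩ := hlast h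
        simpa [Store.set_apply] using ⟨h1.le, h2⟩
  · rintro w ⟨ha, hU, -⟩
    have hI : w rI 0 = i := by rw [ha rI (by simp), hi]
    simp [SExpr.eval, hI, hU]

open SExpr Block in
/-- Append the current code to the list and mark it if it passed both tests. -/
def accept : Block :=
  .ite (reg rFlag) (.ite (sub (add (reg rK) (.const 1)) (reg rAcc))
    (.seq (wr aMark (reg rCode) (add (reg rI) (.const 1)))
      (.seq (wr aList (reg rEnd) (reg rCode)) (setReg rEnd (add (reg rEnd) (.const 1)))))
    .skip) .skip

theorem accept_run (v : Store) :
    accept.run v = if v rFlag 0 ≠ 0 ∧ v rAcc 0 ≤ v rK 0 then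
      ((v.set aMark (v rCode 0) (v rI 0 + 1)).set aList (v rEnd 0) (v rCode 0)).set rEnd 0
        (v rEnd 0 + 1) else v := by
  by_cases h1 : v rFlag 0 = 0
  · simp [accept, Block.run, SExpr.eval, h1]
  by_cases h2 : v rAcc 0 ≤ v rK 0
  · have h3 : v rK 0 + 1 - v rAcc 0 ≠ 0 := by omega
    simp [accept, Block.run, SExpr.eval, Store.set_apply, h1, h2, h3]
  · have h3 : v rK 0 + 1 - v rAcc 0 = 0 := by omega
    simp [accept, Block.run, SExpr.eval, h1, h2, h3]

/-- Decide whether the current code belongs to a reachable set, and record it if so. -/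
def process : Program :=
  .seq decode (.seq countArcs (.seq search accept.compile))

/-- The store holds the input and the tables that are used for the vertices below `i + 1`. -/
structure HasTables (adj : ℕ → ℕ → Prop) (k n i : ℕ) (v : Store) : Prop where
  n_eq : v rN 0 = n
  k_eq : v rK 0 = k
  i_eq : v rI 0 = i
  pow_eq : ∀ u ≤ i, v aPow u = 2 ^ u
  row_eq : ∀ u ≤ i, v aRow u = u * n
  arc : ∀ u < n, ∀ w < n, adj u w → v aAdj (u * n + w) = 1
  no_arc : ∀ u < n, ∀ w < n, ¬ adj u w → v aAdj (u * n + w) = 0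

theorem HasTables.agree {adj : ℕ → ℕ → Prop} {k n i : ℕ} {v v' : Store} {l : List (Fin 22)}
    (h : HasTables adj k n i v) (ha : AgreeOff l v v')
    (hl : ∀ j ∈ [rN, rK, rI, aPow, aRow, aAdj], j ∉ l) : HasTables adj k n i v' := by
  simp only [List.forall_mem_cons] at hl
  obtain ⟨h1, h2, h3, h4, h5, h6, -⟩ := hl
  constructor
  · rw [ha _ h1]; exact h.n_eq
  · rw [ha _ h2]; exact h.k_eq
  · rw [ha _ h3]; exact h.i_eq
  · rw [ha _ h4]; exact h.pow_eq
  · rw [ha _ h5]; exact h.row_eq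
  · rw [ha _ h6]; exact h.arc
  · rw [ha _ h6]; exact h.no_arc

theorem HasTables.sum_backArc {adj : ℕ → ℕ → Prop} {k n i : ℕ} {v : Store}
    (h : HasTables adj k n i v) (hi : i < n) {A : Finset ℕ}
    (hbit : ∀ u ≤ i, v aBit u = if u ∈ A then 1 else 0) :
    ∑ u ∈ Finset.range (i + 1), ∑ w ∈ Finset.range (i + 1), v.backArc u w =
      (backArcs adj (i + 1) A).card := by
  classical
  rw [backArcs, Finset.card_filter, Finset.sum_product]
  refine Finset.sum_congr rfl fun u hu => Finset.sum_congr rfl fun w hw => ?_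
  rw [Finset.mem_range] at hu hw
  rw [Store.backArc, h.row_eq u (by omega), hbit u (by omega), hbit w (by omega)]
  by_cases h1 : adj u w
  · rw [h.arc u (by omega) w (by omega) h1]
    by_cases h2 : u ∈ A <;> by_cases h3 : w ∈ A <;> simp [h1, h2, h3]
  · rw [h.no_arc u (by omega) w (by omega) h1]
    by_cases h2 : u ∈ A <;> by_cases h3 : w ∈ A <;> simp [h1, h2, h3]

open Classical in
/-- The candidates in `done` have been processed for the vertices below `i + 1`, the list of
reachable sets starting at address `s`. -/
structure Progress (adj : ℕ → ℕ → Prop) (k i s : ℕ) (done : List (Finset ℕ)) (v : Store) :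
    Prop where
  mark_le : ∀ c, v aMark c ≤ i + 1
  mark_iff : ∀ B, v aMark (setCode B) = i + 1 ↔ B ∈ done ∧ Reachable adj k (i + 1) B
  end_eq : v rEnd 0 = s + (done.filter (Reachable adj k (i + 1))).length
  list_eq : ∀ q (hq : q < (done.filter (Reachable adj k (i + 1))).length),
    v aList (s + q) = setCode (done.filter (Reachable adj k (i + 1)))[q]
  last_mem : ∀ B ∈ done, B ≠ ∅ → Reachable adj k (i + 1) B →
    v aLast (setCode B) ∈ B ∧ Reachable adj k (i + 1) (B.erase (v aLast (setCode B)))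

theorem Progress.congr {adj : ℕ → ℕ → Prop} {k i s : ℕ} {done : List (Finset ℕ)} {v v' : Store}
    (h : Progress adj k i s done v) (h1 : v' aMark = v aMark) (h2 : v' rEnd = v rEnd)
    (h3 : v' aList = v aList) (h4 : v' aLast = v aLast) : Progress adj k i s done v' := by
  constructor
  · rw [h1]; exact h.mark_le
  · rw [h1]; exact h.mark_iff
  · rw [h2]; exact h.end_eq
  · rw [h3]; exact h.list_eq
  · rw [h4]; exact h.last_mem

/-- The arrays that `process` changes. -/
abbrev processArrays : List (Fin 22) :=
  [rRem, rU, aBit, rAcc, rW, rFlag, aLast, aMark, aList, rEnd]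

theorem exists_exec_process : ∃ C, ∀ (adj : ℕ → ℕ → Prop) (k n i s : ℕ) (done : List (Finset ℕ))
    (A : Finset ℕ) (v : Store), HasTables adj k n i v → i < n → Progress adj k i s done v →
    A ⊆ Finset.range (i + 1) → v rCode 0 = setCode A →
    (∀ u ∈ A, Reachable adj k (i + 1) (A.erase u) → A.erase u ∈ done) →
    ∃ v', Exec process v (C * (i + 2) ^ 2) v' ∧ AgreeOff processArrays v v' ∧
      Progress adj k i s (done ++ [A]) v' ∧ ∀ x < s, v' aList x = v aList x := by
  classical
  obtain ⟨C₁, hC₁⟩ := exists_exec_decode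
  obtain ⟨C₂, hC₂⟩ := exists_exec_countArcs
  obtain ⟨C₃, hC₃⟩ := exists_exec_search
  refine ⟨C₁ + C₂ + C₃ + accept.time, fun adj k n i s done A v ht hin hp hA hcode hdone => ?_⟩
  obtain ⟨v₁, hx₁, ha₁, hbit₁⟩ := hC₁ v i A hA ht.i_eq ht.pow_eq hcode
  have ht₁ := ht.agree ha₁ (by simp)
  obtain ⟨v₂, hx₂, ha₂, hacc₂⟩ := hC₂ v₁ i ht₁.i_eq
  rw [ht₁.sum_backArc hin hbit₁] at hacc₂
  have ht₂ := ht₁.agree ha₂ (by simp)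
  obtain ⟨v₃, hx₃, ha₃, hoff₃, hflag₃, hlast₃⟩ := hC₃ v₂ i ht₂.i_eq
  have ht₃ := ht₂.agree ha₃ (by simp)
  have hexec := hx₁.seq (hx₂.seq (hx₃.seq (accept.exec v₃)))
  have ha : AgreeOff processArrays v v₃ :=
    (ha₁.mono (by simp)).trans ((ha₂.mono (by simp)).trans (ha₃.mono (by simp)))
  have hcode₂ : v₂ rCode 0 = setCode A := by
    rw [ha₂ _ (by simp), ha₁ _ (by simp), hcode]
  have hcode₃ : v₃ rCode 0 = setCode A := by rw [ha₃ _ (by simp), hcode₂]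
  have hmark₂ : v₂ aMark = v aMark := by rw [ha₂ _ (by simp), ha₁ _ (by simp)]
  have hmark₃ : v₃ aMark = v aMark := by rw [ha₃ _ (by simp), hmark₂]
  have hlist₃ : v₃ aList = v aList := by
    rw [ha₃ _ (by simp), ha₂ _ (by simp), ha₁ _ (by simp)]
  have hend₃ : v₃ rEnd = v rEnd := by
    rw [ha₃ _ (by simp), ha₂ _ (by simp), ha₁ _ (by simp)]
  have hlast₂ : v₂ aLast = v aLast := by
    rw [ha₂ _ (by simp), ha₁ _ (by simp)]
  have hacc₃ : v₃ rAcc 0 = (backArcs adj (i + 1) A).card := by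
    rw [ha₃ _ (by simp), hacc₂]
  have hisLast : ∀ u < i + 1, v₂.IsLast u ↔ u ∈ A ∧ Reachable adj k (i + 1) (A.erase u) := by
    intro u hu
    rw [Store.IsLast, ha₂ aBit (by simp), hbit₁ u (by omega), ht₂.i_eq, hcode₂,
      ht₂.pow_eq u (by omega), hmark₂]
    by_cases huA : u ∈ A
    · rw [← setCode_erase huA]
      simp only [huA, if_true, ne_eq, one_ne_zero, not_false_eq_true, true_and]
      have h1 := hp.mark_le (setCode (A.erase u))
      have h2 := hp.mark_iff (A.erase u)
      constructor
      · intro h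
        exact (h2.1 (by omega)).2
      · intro h
        have := h2.2 ⟨hdone u huA h, h⟩
        omega
    · simp [huA]
  have hexists : (∃ u < i + 1, v₂.IsLast u) ↔ ∃ u ∈ A, Reachable adj k (i + 1) (A.erase u) := by
    constructor
    · rintro ⟨u, hu, h⟩
      exact ⟨u, (hisLast u hu).1 h⟩
    · rintro ⟨u, hu, h⟩
      have hlt := Finset.mem_range.1 (hA hu)
      exact ⟨u, hlt, (hisLast u hlt).2 ⟨hu, h⟩⟩
  rw [hcode₂, hexists, setCode_eq_zero] at hflag₃
  rw [hexists, hcode₂] at hlast₃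
  rw [hcode₂, hlast₂] at hoff₃
  have hreach := reachable_iff (adj := adj) (k := k) hA
  have hcond : (v₃ rFlag 0 ≠ 0 ∧ v₃ rAcc 0 ≤ v₃ rK 0) ↔ Reachable adj k (i + 1) A := by
    rw [hreach, hflag₃, hacc₃, ht₃.k_eq, and_comm]
  have htime : C₁ * (i + 2) + (C₂ * (i + 2) ^ 2 + (C₃ * (i + 2) + accept.time)) ≤
      (C₁ + C₂ + C₃ + accept.time) * (i + 2) ^ 2 := by
    have h1 : i + 2 ≤ (i + 2) ^ 2 := Nat.le_self_pow two_ne_zero _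
    have h2 : 1 ≤ (i + 2) ^ 2 := Nat.one_le_pow _ _ (by omega)
    have h3 := Nat.mul_le_mul_left C₁ h1
    have h4 := Nat.mul_le_mul_left C₃ h1
    have h5 := Nat.mul_le_mul_left accept.time h2
    rw [Nat.add_mul, Nat.add_mul, Nat.add_mul]
    omega
  have hlast : ∀ B ∈ done ++ [A], B ≠ ∅ → Reachable adj k (i + 1) B →
      v₃ aLast (setCode B) ∈ B ∧ Reachable adj k (i + 1) (B.erase (v₃ aLast (setCode B))) := by
    intro B hB hne hr
    by_cases hBA : B = A
    · subst hBA
      have h1 := (hreach.1 hr).2.resolve_left hne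
      obtain ⟨h2, h3⟩ := hlast₃ h1
      exact (hisLast _ h2).1 h3
    · rw [hoff₃ _ fun h => hBA (setCode_injective h)]
      refine hp.last_mem B ?_ hne hr
      simpa [hBA] using hB
  refine ⟨accept.run v₃, hexec.mono htime, ?_, ?_, ?_⟩
  · rw [accept_run]
    split_ifs
    · exact ((ha.set (by simp) _ _).set (by simp) _ _).set (by simp) _ _
    · exact ha
  · rw [accept_run, if_congr hcond rfl rfl, hcode₃, ht₃.i_eq]
    split_ifs with hr
    · have hfilter : (done ++ [A]).filter (Reachable adj k (i + 1)) =
          done.filter (Reachable adj k (i + 1)) ++ [A] := by simp [List.filter_append, hr]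
      have hend : v₃ rEnd 0 = s + (done.filter (Reachable adj k (i + 1))).length := by
        rw [hend₃]; exact hp.end_eq
      rw [hend]
      constructor
      · intro c
        have := hp.mark_le c
        simp only [Store.set_apply, hmark₃]
        simp only [Fin.isValue, Fin.reduceEq, false_and, if_false, true_and]
        split_ifs <;> omega
      · intro B
        have h1 := hp.mark_iff B
        simp only [Store.set_apply, hmark₃]
        by_cases hBA : B = A
        · simp [hBA, hr]
        · have h2 : setCode B ≠ setCode A := fun h => hBA (setCode_injective h)
          simpa [hBA, h2] using h1
      · rw [hfilter]
        simp [Store.set_apply, add_assoc]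
      · simp only [hfilter]
        intro q hq
        rw [List.length_append, List.length_singleton] at hq
        rcases Nat.lt_or_ge q (done.filter (Reachable adj k (i + 1))).length with h | h
        · rw [List.getElem_append_left h, ← hp.list_eq q h]
          simp [Store.set_apply, hlist₃, h.ne]
        · obtain rfl : q = (done.filter (Reachable adj k (i + 1))).length := by omega
          simp [Store.set_apply]
      · intro B hB hne hrB
        simpa [Store.set_apply] using hlast B hB hne hrB
    · have hfilter : (done ++ [A]).filter (Reachable adj k (i + 1)) =
          done.filter (Reachable adj k (i + 1)) := by simp [List.filter_append, hr]
      constructor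
      · rw [hmark₃]; exact hp.mark_le
      · intro B
        rw [hmark₃, hp.mark_iff B]
        by_cases hBA : B = A
        · simp [hBA, hr]
        · simp [hBA]
      · rw [hfilter, hend₃]; exact hp.end_eq
      · simp only [hfilter, hlist₃]; exact hp.list_eq
      · exact hlast
  · intro x hx
    rw [accept_run, hend₃, hp.end_eq]
    split_ifs
    · have : x ≠ s + (done.filter (Reachable adj k (i + 1))).length := by omega
      simp [Store.set_apply, hlist₃, this]
    · rw [hlist₃]

open SExpr Block in
/-- Load the next entry of the list, increased by `e`. -/
abbrev load (e : SExpr) : Block := setReg rCode (add (rd aList (reg rPtr)) e)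

open SExpr Block in
/-- Proceed to the next entry of the list. -/
abbrev incrPtr : Block := setReg rPtr (add (reg rPtr) (.const 1))

/-- Process all entries of the list, increased by `e`. -/
def pass (e : SExpr) : Program :=
  .seq (Block.setReg rPtr (.reg rLo)).compile
    (.loop (SExpr.sub (.reg rHi) (.reg rPtr)).compile
      (.seq (load e).compile (.seq process incrPtr.compile)))

/-- The arrays that `pass` changes. -/
abbrev passArrays : List (Fin 22) := rCode :: rPtr :: processArrays

theorem exists_exec_pass (e : SExpr) : ∃ C, ∀ (adj : ℕ → ℕ → Prop) (k n i lo : ℕ)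
    (l done : List (Finset ℕ)) (f : Finset ℕ → Finset ℕ) (v : Store), HasTables adj k n i v →
    i < n → Progress adj k i (lo + l.length) done v → v rLo 0 = lo → v rHi 0 = lo + l.length →
    (∀ q (hq : q < l.length), v aList (lo + q) = setCode l[q]) →
    (∀ w, AgreeOff passArrays v w → e.eval w = e.eval v) →
    (∀ B ∈ l, f B ⊆ Finset.range (i + 1) ∧ setCode (f B) = setCode B + e.eval v) →
    (∀ q (hq : q < l.length), ∀ u ∈ f l[q], Reachable adj k (i + 1) ((f l[q]).erase u) →
      (f l[q]).erase u ∈ done ++ (l.take q).map f) →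
    ∃ v', Exec (pass e) v (C * ((l.length + 1) * (i + 2) ^ 2)) v' ∧ AgreeOff passArrays v v' ∧
      Progress adj k i (lo + l.length) (done ++ l.map f) v' ∧
      ∀ x < lo + l.length, v' aList x = v aList x := by
  obtain ⟨C, hC⟩ := exists_exec_process
  refine ⟨(Block.setReg rPtr (.reg rLo)).time + (load e).time + C + incrPtr.time +
    (SExpr.sub (.reg rHi) (.reg rPtr)).compile.cost + 1,
    fun adj k n i lo l done f v ht hin hp hlo hhi hlist he hf hdone => ?_⟩
  have h1 := (Block.setReg rPtr (.reg rLo)).exec v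
  refine (Exec.loop_of_invariant (e := .sub (.reg rHi) (.reg rPtr))
    (p := .seq (load e).compile (.seq process incrPtr.compile))
    (t := (load e).time + (C * (i + 2) ^ 2 + incrPtr.time)) l.length
    (fun q w => AgreeOff passArrays v w ∧ w rPtr 0 = lo + q ∧
      Progress adj k i (lo + l.length) (done ++ (l.take q).map f) w ∧
      ∀ x < lo + l.length, w aList x = v aList x)
    (v := (Block.setReg rPtr (.reg rLo)).run v) ?_ ?_ ?_).elim ?_
  rotate_left 3
  · rintro v' ⟨h2, ha, -, hp', hl⟩
    refine ⟨v', (h1.seq h2).mono ?_, ha, by rwa [List.take_length] at hp', hl⟩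
    generalize (Block.setReg rPtr (.reg rLo)).time = a
    generalize (load e).time = b
    generalize incrPtr.time = c
    generalize (SExpr.sub (.reg rHi) (.reg rPtr)).compile.cost = d
    have h3 : 1 ≤ (i + 2) ^ 2 := Nat.one_le_pow _ _ (by omega)
    generalize (i + 2) ^ 2 = y at h3 ⊢
    obtain ⟨z, rfl⟩ := Nat.exists_eq_add_of_le h3
    have h4 : a + (l.length + 1) * (b + (C * (1 + z) + c) + d + 1) +
        (a * (l.length + z + l.length * z) + (l.length + 1) * (b + c + d + 1) * z) =
        (a + b + C + c + d + 1) * ((l.length + 1) * (1 + z)) := by ring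
    omega
  · refine ⟨(AgreeOff.refl _ _).set (by simp) _ _, ?_, ?_, ?_⟩
    · simp [Block.run, SExpr.eval, Store.set_apply, hlo]
    · rw [List.take_zero, List.map_nil, List.append_nil]
      exact hp.congr (Store.set_of_ne _ _ _ (by simp)) (Store.set_of_ne _ _ _ (by simp))
        (Store.set_of_ne _ _ _ (by simp)) (Store.set_of_ne _ _ _ (by simp))
    · simp [Block.run, Store.set_apply]
  · rintro q hq w ⟨ha, hptr, hp', hl⟩
    have hhi' : w rHi 0 = lo + l.length := by rw [ha _ (by simp), hhi]
    refine ⟨by simp [SExpr.eval, hhi', hptr]; omega, ?_⟩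
    obtain ⟨hfsub, hfcode⟩ := hf l[q] (List.getElem_mem hq)
    have h2 := (load e).exec w
    set w₁ := (load e).run w with hw₁
    have ha₁ : AgreeOff passArrays v w₁ := ha.set (by simp) _ _
    have hw : ∀ j, j ≠ rCode → w₁ j = w j := fun j hj => Store.set_of_ne _ _ _ hj
    have hcode : w₁ rCode 0 = setCode (f l[q]) := by
      rw [hfcode, ← hlist q hq, ← hl _ (by omega), ← he w ha]
      simp [hw₁, Block.run, SExpr.eval, Store.set_apply, hptr]
    obtain ⟨w₂, hx₂, ha₂, hp₂, hl₂⟩ := hC adj k n i (lo + l.length)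
      (done ++ (l.take q).map f) (f l[q]) w₁ (ht.agree ha₁ (by simp)) hin
      (hp'.congr (hw _ (by simp)) (hw _ (by simp)) (hw _ (by simp)) (hw _ (by simp)))
      hfsub hcode (hdone q hq)
    have hptr₂ : w₂ rPtr 0 = lo + q := by rw [ha₂ _ (by simp), hw _ (by simp), hptr]
    have hw' : ∀ j, j ≠ rPtr → incrPtr.run w₂ j = w₂ j := fun j hj => Store.set_of_ne _ _ _ hj
    refine ⟨incrPtr.run w₂, h2.seq (hx₂.seq (incrPtr.exec w₂)),
      (ha₁.trans (ha₂.mono (by simp))).set (by simp) _ _, ?_, ?_, ?_⟩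
    · simp [Block.run, SExpr.eval, Store.set_apply, hptr₂, add_assoc]
    · rw [← List.take_append_getElem hq, List.map_append, ← List.append_assoc]
      exact hp₂.congr (hw' _ (by simp)) (hw' _ (by simp)) (hw' _ (by simp)) (hw' _ (by simp))
    · intro x hx
      rw [hw' _ (by simp), hl₂ x hx, hw _ (by simp), hl x hx]
  · rintro w ⟨ha, hptr, -⟩
    have hhi' : w rHi 0 = lo + l.length := by rw [ha _ (by simp), hhi]
    simp [SExpr.eval, hhi', hptr]

/-- The entries from `lo` on list the codes of the reachable sets for the vertices below `i`,
in increasing order, and the table of last vertices is correct for them. -/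
structure ListsReachable (adj : ℕ → ℕ → Prop) (k i lo : ℕ) (l : List (Finset ℕ)) (v : Store) :
    Prop where
  sorted : l.Pairwise fun A B => setCode A < setCode B
  mem_iff : ∀ B, B ∈ l ↔ Reachable adj k i B
  lo_eq : v rLo 0 = lo
  hi_eq : v rHi 0 = lo + l.length
  list_eq : ∀ q (hq : q < l.length), v aList (lo + q) = setCode l[q]
  mark_le : ∀ c, v aMark c ≤ i
  last_mem : ∀ B, B ≠ ∅ → Reachable adj k i B →
    v aLast (setCode B) ∈ B ∧ Reachable adj k i (B.erase (v aLast (setCode B)))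

theorem mem_take_of_setCode_lt {l : List (Finset ℕ)}
    (hl : l.Pairwise fun A B => setCode A < setCode B) {q : ℕ} (hq : q < l.length) {B : Finset ℕ}
    (hB : B ∈ l) (hlt : setCode B < setCode l[q]) : B ∈ l.take q := by
  obtain ⟨q', hq', rfl⟩ := List.mem_iff_getElem.1 hB
  rw [List.mem_take_iff_getElem]
  refine ⟨q', ?_, rfl⟩
  by_contra hcon
  rcases (show q ≤ q' by omega).eq_or_lt with rfl | h
  · exact lt_irrefl _ hlt
  · have := List.pairwise_iff_getElem.1 hl q q' hq hq' h
    omega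

open SExpr Block in
/-- Pass to the new list, and test whether it contains the set of all vertices. -/
def finish : Block :=
  .seq (setReg rLo (reg rHi)) (.seq (setReg rHi (reg rEnd))
    (setReg rAlive (sub (rd aMark
      (sub (add (rd aPow (reg rI)) (rd aPow (reg rI))) (.const 1))) (reg rI))))

/-- Compute the list of reachable sets for one more vertex. -/
def stage : Program :=
  .seq (Block.setReg rEnd (.reg rHi)).compile
    (.seq (pass (.const 0)) (.seq (pass (.rd aPow (.reg rI))) finish.compile))

theorem exists_exec_stage : ∃ C, ∀ (adj : ℕ → ℕ → Prop) (k n i lo : ℕ) (l : List (Finset ℕ))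
    (v : Store), HasTables adj k n i v → i < n → ListsReachable adj k i lo l v →
    ∃ v', Exec stage v (C * ((l.length + 1) * (i + 2) ^ 2)) v' ∧
      AgreeOff (rLo :: rHi :: rAlive :: passArrays) v v' ∧
      (∃ lo' l', ListsReachable adj k (i + 1) lo' l' v') ∧
      (v' rAlive 0 ≠ 0 ↔ Reachable adj k (i + 1) (Finset.range (i + 1))) := by
  classical
  obtain ⟨C₁, hC₁⟩ := exists_exec_pass (.const 0)
  obtain ⟨C₂, hC₂⟩ := exists_exec_pass (.rd aPow (.reg rI))
  refine ⟨(Block.setReg rEnd (.reg rHi)).time + C₁ + C₂ + finish.time,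
    fun adj k n i lo l v ht hin hl => ?_⟩
  have hsub : ∀ B ∈ l, B ⊆ Finset.range i := fun B hB => ((hl.mem_iff B).1 hB).subset
  have hsucc : Finset.range i ⊆ Finset.range (i + 1) :=
    Finset.range_subset_range.2 (Nat.le_succ i)
  have hnotMem : ∀ B ∈ l, i ∉ B := fun B hB h => absurd (hsub B hB h) Finset.notMem_range_self
  have h0 := (Block.setReg rEnd (.reg rHi)).exec v
  set v₀ := (Block.setReg rEnd (.reg rHi)).run v with hv₀
  have hv : ∀ j, j ≠ rEnd → v₀ j = v j := fun j hj => Store.set_of_ne _ _ _ hj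
  have ha₀ : AgreeOff passArrays v v₀ := (AgreeOff.refl _ _).set (by simp) _ _
  have ht₀ := ht.agree ha₀ (by simp)
  have hp₀ : Progress adj k i (lo + l.length) [] v₀ := by
    constructor
    · intro c
      rw [hv _ (by simp)]
      exact (hl.mark_le c).trans (Nat.le_succ i)
    · intro B
      have := hl.mark_le (setCode B)
      rw [hv _ (by simp)]
      simp only [List.not_mem_nil, false_and, iff_false]
      omega
    · simp [hv₀, Block.run, SExpr.eval, Store.set_apply, hl.hi_eq]
    · simp
    · simp
  obtain ⟨v₁, hx₁, ha₁, hp₁, hl₁⟩ := hC₁ adj k n i lo l [] id v₀ ht₀ hin hp₀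
    (by rw [hv _ (by simp), hl.lo_eq]) (by rw [hv _ (by simp), hl.hi_eq])
    (by rw [hv _ (by simp)]; exact hl.list_eq) (fun _ _ => rfl)
    (fun B hB => ⟨(hsub B hB).trans hsucc, rfl⟩)
    (by
      intro q hq u hu hr
      rw [List.map_id, List.nil_append]
      rw [id_eq] at hu hr ⊢
      have hmem := List.getElem_mem hq
      refine mem_take_of_setCode_lt hl.sorted hq ?_ ?_
      · rw [hl.mem_iff]
        have := hr.erase_last
        rwa [Finset.erase_eq_of_notMem
          fun h => hnotMem _ hmem (Finset.mem_of_mem_erase h)] at this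
      · exact Finset.sum_lt_sum_of_subset (Finset.erase_subset _ _) hu (Finset.notMem_erase _ _)
          (by positivity) fun _ _ _ => Nat.zero_le _)
  rw [List.map_id, List.nil_append] at hp₁
  have ht₁ := ht₀.agree ha₁ (by simp)
  have hlist₁ : ∀ q (hq : q < l.length), v₁ aList (lo + q) = setCode l[q] := by
    intro q hq
    rw [hl₁ _ (by omega), hv _ (by simp), hl.list_eq q hq]
  obtain ⟨v₂, hx₂, ha₂, hp₂, hl₂⟩ := hC₂ adj k n i lo l l (insert i) v₁ ht₁ hin hp₁
    (by rw [ha₁ _ (by simp), hv _ (by simp), hl.lo_eq])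
    (by rw [ha₁ _ (by simp), hv _ (by simp), hl.hi_eq]) hlist₁
    (fun w hw => by
      simp only [SExpr.eval]
      rw [hw _ (by simp), hw _ (by simp)])
    (fun B hB => by
      refine ⟨Finset.insert_subset (Finset.self_mem_range_succ i) ((hsub B hB).trans hsucc), ?_⟩
      simp only [SExpr.eval]
      rw [setCode_insert (hnotMem B hB), ht₁.i_eq, ht₁.pow_eq i le_rfl])
    (by
      intro q hq u hu hr
      have hmem := List.getElem_mem hq
      rcases eq_or_ne u i with rfl | hne
      · rw [Finset.erase_insert (hnotMem _ hmem)]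
        exact List.mem_append_left _ hmem
      · rw [Finset.erase_insert_of_ne hne.symm] at hr ⊢
        refine List.mem_append_right _ (List.mem_map_of_mem ?_)
        refine mem_take_of_setCode_lt hl.sorted hq ?_ ?_
        · rw [hl.mem_iff]
          have := hr.erase_last
          rwa [Finset.erase_insert
            fun h => hnotMem _ hmem (Finset.mem_of_mem_erase h)] at this
        · exact Finset.sum_lt_sum_of_subset (Finset.erase_subset _ _)
            (Finset.mem_of_mem_insert_of_ne hu hne) (Finset.notMem_erase _ _)
            (by positivity) fun _ _ _ => Nat.zero_le _)
  have ht₂ := ht₁.agree ha₂ (by simp)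
  have hcand : ∀ B, Reachable adj k (i + 1) B → B ∈ l ++ l.map (insert i) := by
    intro B hB
    have h1 := (hl.mem_iff _).2 hB.erase_last
    by_cases hi : i ∈ B
    · refine List.mem_append_right _ (List.mem_map.2 ⟨_, h1, Finset.insert_erase hi⟩)
    · rw [Finset.erase_eq_of_notMem hi] at h1
      exact List.mem_append_left _ h1
  have hsorted : (l ++ l.map (insert i)).Pairwise fun A B => setCode A < setCode B := by
    rw [List.pairwise_append, List.pairwise_map]
    refine ⟨hl.sorted, hl.sorted.imp_of_mem fun hA hB h => ?_, ?_⟩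
    · rw [setCode_insert (hnotMem _ hA), setCode_insert (hnotMem _ hB)]
      omega
    · intro A hA B hB
      obtain ⟨B, hB', rfl⟩ := List.mem_map.1 hB
      rw [setCode_insert (hnotMem _ hB')]
      have := setCode_lt (hsub A hA)
      omega
  have hfin : finish.run v₂ = ((v₂.set rLo 0 (lo + l.length)).set rHi 0 (v₂ rEnd 0)).set rAlive 0
      (v₂ aMark (2 ^ (i + 1) - 1) - i) := by
    have h1 : v₂ rHi 0 = lo + l.length := by
      rw [ha₂ _ (by simp), ha₁ _ (by simp), hv _ (by simp), hl.hi_eq]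
    simp [finish, Block.run, SExpr.eval, Store.set_apply, h1, ht₂.i_eq, ht₂.pow_eq i le_rfl,
      pow_succ, mul_two]
  refine ⟨finish.run v₂, (h0.seq (hx₁.seq (hx₂.seq (finish.exec v₂)))).mono ?_, ?_,
    ⟨lo + l.length, (l ++ l.map (insert i)).filter (Reachable adj k (i + 1)), ?_⟩, ?_⟩
  · have h1 : 1 ≤ (l.length + 1) * (i + 2) ^ 2 := Nat.mul_pos (by omega) (by positivity)
    generalize (l.length + 1) * (i + 2) ^ 2 = y at h1 ⊢
    have h2 := Nat.mul_le_mul_left (Block.setReg rEnd (.reg rHi)).time h1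
    have h3 := Nat.mul_le_mul_left finish.time h1
    rw [Nat.add_mul, Nat.add_mul, Nat.add_mul]
    omega
  · rw [hfin]
    refine AgreeOff.set (AgreeOff.set (AgreeOff.set ?_ (by simp) _ _) (by simp) _ _)
      (by simp) _ _
    exact (ha₀.trans (ha₁.trans ha₂)).mono (by simp)
  · rw [hfin]
    constructor
    · exact hsorted.filter _
    · intro B
      rw [List.mem_filter, decide_eq_true_iff]
      exact ⟨fun h => h.2, fun h => ⟨hcand B h, h⟩⟩
    · simp [Store.set_apply]
    · simpa [Store.set_apply] using hp₂.end_eq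
    · intro q hq
      simpa [Store.set_apply] using hp₂.list_eq q hq
    · intro c
      simpa [Store.set_apply] using hp₂.mark_le c
    · intro B hne hr
      simpa [Store.set_apply] using hp₂.last_mem B (hcand B hr) hne hr
  · rw [hfin]
    have h1 := hp₂.mark_le (2 ^ (i + 1) - 1)
    have h2 := hp₂.mark_iff (Finset.range (i + 1))
    rw [setCode_range] at h2
    have h3 : v₂ aMark (2 ^ (i + 1) - 1) = i + 1 ↔
        Reachable adj k (i + 1) (Finset.range (i + 1)) :=
      h2.trans ⟨fun h => h.2, fun h => ⟨hcand _ h, h⟩⟩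
    rw [← h3]
    simp only [Store.set_apply, and_self, if_true]
    omega

open SExpr Block in
/-- Extend the tables by one entry and proceed to the next vertex. -/
def advance : Block :=
  .seq (wr aPow (add (reg rI) (.const 1)) (add (rd aPow (reg rI)) (rd aPow (reg rI))))
    (.seq (wr aRow (add (reg rI) (.const 1)) (add (rd aRow (reg rI)) (reg rN)))
      (setReg rI (add (reg rI) (.const 1))))

/-- Compute the lists of reachable sets for all initial segments of the vertices, until one is not
reachable itself. -/
def allStages : Program :=
  .loop (SExpr.sub (.reg rN) (.reg rI)).compile
    (.seq (.ite (SExpr.reg rAlive).compile stage .skip) advance.compile)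

open Classical in
/-- Every initial segment of the vertices that is itself reachable contains at most `X` reachable
sets. -/
def ReachableBound (adj : ℕ → ℕ → Prop) (k n X : ℕ) : Prop :=
  ∀ i ≤ n, Reachable adj k i (Finset.range i) →
    ((Finset.range i).powerset.filter (Reachable adj k i)).card ≤ X

theorem ListsReachable.length_le {adj : ℕ → ℕ → Prop} {k n i lo X : ℕ} {l : List (Finset ℕ)}
    {v : Store} (h : ListsReachable adj k i lo l v) (hX : ReachableBound adj k n X) (hi : i ≤ n)
    (hr : Reachable adj k i (Finset.range i)) : l.length ≤ X := by
  classical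
  have hnodup : l.Nodup := h.sorted.imp fun hlt heq => by rw [heq] at hlt; exact lt_irrefl _ hlt
  rw [← List.toFinset_card_of_nodup hnodup]
  refine (Finset.card_le_card fun B hB => ?_).trans (hX i hi hr)
  have hB' := (h.mem_iff B).1 (List.mem_toFinset.1 hB)
  exact Finset.mem_filter.2 ⟨Finset.mem_powerset.2 hB'.subset, hB'⟩

theorem HasTables.advance {adj : ℕ → ℕ → Prop} {k n i : ℕ} {v : Store}
    (h : HasTables adj k n i v) : HasTables adj k n (i + 1) (advance.run v) := by
  have hrun : RAM.advance.run v =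
      ((v.set aPow (i + 1) (2 ^ (i + 1))).set aRow (i + 1) ((i + 1) * n)).set rI 0 (i + 1) := by
    simp [RAM.advance, Block.run, SExpr.eval, Store.set_apply, h.i_eq, h.pow_eq i le_rfl,
      h.row_eq i le_rfl, h.n_eq, pow_succ, mul_two, Nat.succ_mul]
  rw [hrun]
  constructor
  · simpa [Store.set_apply] using h.n_eq
  · simpa [Store.set_apply] using h.k_eq
  · simp [Store.set_apply]
  · intro u hu
    by_cases hu' : u = i + 1
    · simp [Store.set_apply, hu']
    · simpa [Store.set_apply, hu'] using h.pow_eq u (by omega)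
  · intro u hu
    by_cases hu' : u = i + 1
    · simp [Store.set_apply, hu']
    · simpa [Store.set_apply, hu'] using h.row_eq u (by omega)
  · simpa [Store.set_apply] using h.arc
  · simpa [Store.set_apply] using h.no_arc

theorem ListsReachable.congr {adj : ℕ → ℕ → Prop} {k i lo : ℕ} {l : List (Finset ℕ)}
    {v v' : Store} (h : ListsReachable adj k i lo l v) (h1 : v' rLo = v rLo) (h2 : v' rHi = v rHi)
    (h3 : v' aList = v aList) (h4 : v' aMark = v aMark) (h5 : v' aLast = v aLast) :
    ListsReachable adj k i lo l v' := by
  refine ⟨h.sorted, h.mem_iff, ?_, ?_, ?_, ?_, ?_⟩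
  · rw [h1]; exact h.lo_eq
  · rw [h2]; exact h.hi_eq
  · rw [h3]; exact h.list_eq
  · rw [h4]; exact h.mark_le
  · rw [h5]; exact h.last_mem

theorem advance_run_of_ne (v : Store) {j : Fin 22} (h1 : j ≠ aPow) (h2 : j ≠ aRow) (h3 : j ≠ rI) :
    advance.run v j = v j := by
  simp only [advance, Block.run]
  rw [Store.set_of_ne _ _ _ h3, Store.set_of_ne _ _ _ h2, Store.set_of_ne _ _ _ h1]

theorem exists_exec_allStages : ∃ C, ∀ (adj : ℕ → ℕ → Prop) (k n lo X : ℕ) (l : List (Finset ℕ))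
    (v : Store), HasTables adj k n 0 v → v rAlive 0 ≠ 0 → ListsReachable adj k 0 lo l v →
    ReachableBound adj k n X →
    ∃ v', Exec allStages v (C * ((n + 2) ^ 3 * (X + 1))) v' ∧ HasTables adj k n n v' ∧
      (v' rAlive 0 ≠ 0 ↔ Reachable adj k n (Finset.range n)) ∧
      (v' rAlive 0 ≠ 0 → ∃ lo' l', ListsReachable adj k n lo' l' v') := by
  obtain ⟨C, hC⟩ := exists_exec_stage
  refine ⟨(SExpr.reg rAlive).compile.cost + C + advance.time +
    (SExpr.sub (.reg rN) (.reg rI)).compile.cost + 3, fun adj k n lo X l v ht halive hl hX => ?_⟩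
  refine (Exec.loop_of_invariant (e := .sub (.reg rN) (.reg rI))
    (p := .seq (.ite (SExpr.reg rAlive).compile stage .skip) advance.compile)
    (t := (SExpr.reg rAlive).compile.cost + 1 + (C * ((X + 1) * (n + 2) ^ 2) + 1) + advance.time) n
    (fun i w => HasTables adj k n i w ∧
      (w rAlive 0 ≠ 0 ↔ Reachable adj k i (Finset.range i)) ∧
      (w rAlive 0 ≠ 0 → ∃ lo' l', ListsReachable adj k i lo' l' w))
    (v := v) ?_ ?_ ?_).elim ?_
  rotate_left 3
  · rintro v' ⟨hx, h⟩
    refine ⟨v', hx.mono ?_, h⟩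
    generalize (SExpr.reg rAlive).compile.cost = a
    generalize advance.time = b
    generalize (SExpr.sub (.reg rN) (.reg rI)).compile.cost = d
    have h1 : 1 ≤ (X + 1) * (n + 2) ^ 2 := Nat.mul_pos (by omega) (by positivity)
    have h2 : (n + 2) ^ 3 * (X + 1) = (n + 2) * ((X + 1) * (n + 2) ^ 2) := by ring
    rw [h2]
    generalize (X + 1) * (n + 2) ^ 2 = y at h1 ⊢
    calc (n + 1) * (a + 1 + (C * y + 1) + b + d + 1)
        ≤ (n + 2) * ((a + C + b + d + 3) * y) := by
          refine Nat.mul_le_mul (by omega) ?_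
          have h3 := Nat.mul_le_mul_left (a + b + d + 3) h1
          rw [show a + C + b + d + 3 = (a + b + d + 3) + C by ring, Nat.add_mul]
          omega
      _ = _ := by ring
  · refine ⟨ht, ⟨fun _ => ?_, fun _ => halive⟩, fun _ => ⟨lo, l, hl⟩⟩
    rw [Finset.range_zero]
    exact .empty
  · rintro i hi w ⟨ht, hiff, hlist⟩
    refine ⟨by simp [SExpr.eval, ht.n_eq, ht.i_eq]; omega, ?_⟩
    by_cases hw : w rAlive 0 = 0
    · refine ⟨advance.run w, (Exec.seq (.ite_false (e := .reg rAlive) hw (Block.skip.exec w)) (advance.exec w)).mono ?_,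
        ht.advance, ?_, ?_⟩
      · simp only [Block.time]
        omega
      · rw [advance_run_of_ne _ (by simp) (by simp) (by simp)]
        simp only [hw, ne_eq, not_true_eq_false, false_iff]
        intro h
        exact hiff.2 (h.range_mono (Nat.le_succ i)) hw
      · rw [advance_run_of_ne _ (by simp) (by simp) (by simp)]
        exact fun h => absurd hw h
    · obtain ⟨lo', l', hl'⟩ := hlist hw
      have hlen := hl'.length_le hX hi.le (hiff.1 hw)
      obtain ⟨w', hx, ha, hl'', hiff'⟩ := hC adj k n i lo' l' w ht hi hl'
      refine ⟨advance.run w', (Exec.seq (.ite_true (e := .reg rAlive) hw hx) (advance.exec w')).mono ?_,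
        (ht.agree ha (by simp)).advance, ?_, ?_⟩
      · have h1 : (l'.length + 1) * (i + 2) ^ 2 ≤ (X + 1) * (n + 2) ^ 2 :=
          Nat.mul_le_mul (by omega) (Nat.pow_le_pow_left (by omega) 2)
        have h2 := Nat.mul_le_mul_left C h1
        omega
      · rwa [advance_run_of_ne _ (by simp) (by simp) (by simp)]
      · intro _
        obtain ⟨lo'', l'', hl''⟩ := hl''
        exact ⟨lo'', l'', hl''.congr (advance_run_of_ne _ (by simp) (by simp) (by simp))
          (advance_run_of_ne _ (by simp) (by simp) (by simp))
          (advance_run_of_ne _ (by simp) (by simp) (by simp))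
          (advance_run_of_ne _ (by simp) (by simp) (by simp))
          (advance_run_of_ne _ (by simp) (by simp) (by simp))⟩
  · rintro w ⟨ht, -⟩
    simp [SExpr.eval, ht.n_eq, ht.i_eq]

/-! ### Output -/

open SExpr Block in
/-- Start from the set of all vertices. -/
def traceInit : Block :=
  .seq (setReg rCode (sub (rd aPow (reg rN)) (.const 1))) (setReg rCnt (reg rN))

open SExpr Block in
/-- Remove the last vertex from the current set. -/
def traceStep : Block :=
  .seq (setReg rCnt (sub (reg rCnt) (.const 1)))
    (.seq (setReg rW (rd aLast (reg rCode)))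
      (setReg rCode (sub (reg rCode) (rd aPow (reg rW)))))

/-- Write the last vertex to the output. -/
def emit : Program :=
  .store (.add (.const 1) (SExpr.reg rCnt).compile) (SExpr.reg rW).compile

/-- Write an ordering to the output. -/
def trace : Program :=
  .seq traceInit.compile
    (.seq (.loop (SExpr.reg rCnt).compile (.seq traceStep.compile emit))
      (.store (.const 0) (.const 1)))

theorem exists_runs_trace : ∃ C, ∀ (adj : ℕ → ℕ → Prop) (k n lo b : ℕ) (l : List (Finset ℕ))
    (low : ℕ → ℕ) (v : Store), n < b → HasTables adj k n n v → ListsReachable adj k n lo l v →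
    Reachable adj k n (Finset.range n) →
    ∃ t ≤ C * (n + 1), ∃ m, Runs trace (layout b low v) t m ∧ m 0 = 1 ∧
      ∃ S : ℕ → Finset ℕ, (∀ t ≤ n, Reachable adj k n (S t) ∧ (S t).card = t) ∧
        ∀ t < n, m (1 + t) ∈ S (t + 1) ∧ S t = (S (t + 1)).erase (m (1 + t)) := by
  refine ⟨traceInit.time + (traceStep.time + ((Expr.add (.const 1) (SExpr.reg rCnt).compile).cost +
    (SExpr.reg rW).compile.cost + 1) + (SExpr.reg rCnt).compile.cost + 1) + 3,
    fun adj k n lo b l low v hb ht hl hr => ?_⟩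
  have hb0 : 0 < b := by omega
  obtain ⟨t₁, ht₁, hr₁⟩ := traceInit.exec v b low hb0
  set v₁ := traceInit.run v with hv₁
  have hv₁' : v₁ = (v.set rCode 0 (2 ^ n - 1)).set rCnt 0 n := by
    simp [hv₁, traceInit, Block.run, SExpr.eval, Store.set_apply, ht.n_eq, ht.pow_eq n le_rfl]
  refine (Runs.loop_of_invariant (e := (SExpr.reg rCnt).compile)
    (p := .seq traceStep.compile emit) (t := traceStep.time +
      ((Expr.add (.const 1) (SExpr.reg rCnt).compile).cost + (SExpr.reg rW).compile.cost + 1))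
    (N := n) (fun q m => ∃ low' w, m = layout b low' w ∧ AgreeOff [rCode, rCnt, rW] v w ∧
      w rCnt 0 = n - q ∧ ∃ S : ℕ → Finset ℕ, w rCode 0 = setCode (S (n - q)) ∧
        (∀ t ≤ n, n - q ≤ t → Reachable adj k n (S t) ∧ (S t).card = t) ∧
        ∀ t < n, n - q ≤ t → low' (1 + t) ∈ S (t + 1) ∧
          S t = (S (t + 1)).erase (low' (1 + t)))
    (m := layout b low v₁) ?_ ?_ ?_).elim ?_
  rotate_left 3
  · rintro t₂ ⟨ht₂, _, hr₂, low', w, rfl, -, -, S, -, hS, hS'⟩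
    refine ⟨_, ?_, _, hr₁.seq (hr₂.seq (Runs.store (.const 0) (.const 1) _)), ?_, S, ?_, ?_⟩
    · generalize traceInit.time = a at *
      generalize traceStep.time + ((Expr.add (.const 1) (SExpr.reg rCnt).compile).cost +
        (SExpr.reg rW).compile.cost + 1) + (SExpr.reg rCnt).compile.cost + 1 = d at *
      simp only [Expr.cost]
      nlinarith
    · simp [Expr.eval]
    · exact fun t ht => hS t ht (by omega)
    · intro t ht
      have h1 : Function.update (layout b low' w) ((Expr.const 0).eval (layout b low' w))
          ((Expr.const 1).eval (layout b low' w)) (1 + t) = low' (1 + t) := by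
        simp only [Expr.eval]
        rw [Function.update_of_ne (by omega), layout_low _ _ (by omega) (by omega)]
      rw [h1]
      exact hS' t ht (by omega)
  · rintro q hq _ ⟨low', w, rfl, ha, hcnt, S, hcode, hS, hS'⟩
    refine ⟨by rw [SExpr.eval_compile hb0]; simp [SExpr.eval, hcnt]; omega, ?_⟩
    obtain ⟨p, hp⟩ : ∃ p, n - q = p + 1 := ⟨n - q - 1, by omega⟩
    have hp' : n - (q + 1) = p := by omega
    rw [hp] at hcnt hcode hS hS'
    rw [hp']
    obtain ⟨hSr, hSc⟩ := hS (p + 1) (by omega) le_rfl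
    have hne : S (p + 1) ≠ ∅ := fun h => by simp [h] at hSc
    obtain ⟨hu, hur⟩ := hl.last_mem _ hne hSr
    set u := v aLast (setCode (S (p + 1))) with hu_def
    have hun : u ≤ n := (Finset.mem_range.1 (hSr.subset hu)).le
    have hlast : w aLast = v aLast := ha _ (by simp)
    have hpow : w aPow u = 2 ^ u := by rw [ha _ (by simp)]; exact ht.pow_eq u hun
    have hrun : traceStep.run w =
        ((w.set rCnt 0 p).set rW 0 u).set rCode 0 (setCode ((S (p + 1)).erase u)) := by
      rw [setCode_erase hu]
      simp [traceStep, Block.run, SExpr.eval, Store.set_apply, hcnt, hcode, hlast, ← hu_def, hpow]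
    obtain ⟨s, hs, hrs⟩ := traceStep.exec w b low' hb0
    have hemit := Runs.store (.add (.const 1) (SExpr.reg rCnt).compile) (SExpr.reg rW).compile
      (layout b low' (traceStep.run w))
    have he1 : (Expr.add (.const 1) (SExpr.reg rCnt).compile).eval
        (layout b low' (traceStep.run w)) = 1 + p := by
      rw [Expr.eval, SExpr.eval_compile hb0, hrun]
      simp [Expr.eval, SExpr.eval, Store.set_apply]
    have he2 : (SExpr.reg rW).compile.eval (layout b low' (traceStep.run w)) = u := by
      rw [SExpr.eval_compile hb0, hrun]
      simp [SExpr.eval, Store.set_apply]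
    rw [he1, he2, update_layout_low _ _ _ (by omega) (by omega)] at hemit
    refine ⟨_, by omega, _, hrs.seq hemit, _, _, rfl, ?_, ?_,
      Function.update S p ((S (p + 1)).erase u), ?_, ?_, ?_⟩
    · rw [hrun]
      exact ((ha.set (by simp) _ _).set (by simp) _ _).set (by simp) _ _
    · rw [hrun]
      simp [Store.set_apply]
    · rw [hrun]
      simp [Store.set_apply]
    · intro t htn hpt
      rcases eq_or_ne t p with rfl | hne
      · rw [Function.update_self, Finset.card_erase_of_mem hu, hSc]
        exact ⟨hur, by omega⟩
      · rw [Function.update_of_ne hne]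
        exact hS t htn (by omega)
    · intro t htn hpt
      rw [Function.update_of_ne (show t + 1 ≠ p by omega)]
      rcases eq_or_ne t p with rfl | hne
      · rw [Function.update_self, Function.update_self]
        exact ⟨hu, rfl⟩
      · rw [Function.update_of_ne hne, Function.update_of_ne (by omega)]
        exact hS' t htn (by omega)
  · rintro _ ⟨low', w, rfl, -, hcnt, -⟩
    rw [SExpr.eval_compile hb0]
    simp [SExpr.eval, hcnt]
  · refine ⟨low, v₁, rfl, ?_, ?_, fun _ => Finset.range n, ?_, ?_, ?_⟩
    · rw [hv₁']
      exact ((AgreeOff.refl _ _).set (by simp) _ _).set (by simp) _ _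
    · simp [hv₁', Store.set_apply]
    · simp [hv₁', Store.set_apply, setCode_range]
    · intro t htn hnt
      obtain rfl : t = n := by omega
      exact ⟨hr, Finset.card_range _⟩
    · intro t htn hnt
      omega

/-! ### Initialization -/

open RAM.Expr in
/-- Compute the square of the content of cell `0` in the unused cell `n + 3`. -/
def square : Program :=
  .seq (.store (.const 2) (cell (.const 0)))
    (.loop (cell (.const 2))
      (.seq (.store (.const 2) (sub (cell (.const 2)) (.const 1)))
        (.store (.add (cell (.const 0)) (.const 3))
          (add (cell (.add (cell (.const 0)) (.const 3))) (cell (.const 0))))))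

theorem Runs.store_of_eval {a e : Expr} {m : Memory} {x y : ℕ} (hx : a.eval m = x)
    (hy : e.eval m = y) :
    Runs (.store a e) m (a.cost + e.cost + 1) (Function.update m x y) := by
  rw [← hx, ← hy]
  exact .store a e m

theorem exists_runs_square : ∃ C, ∀ (n : ℕ) (m : Memory), m 0 = n → m 2 = 0 → m (n + 3) = 0 →
    ∃ t ≤ C * (n + 1), Runs square m t (Function.update m (n + 3) (n * n)) := by
  refine ⟨30, fun n m h0 h2 h3 => ?_⟩
  refine (Runs.loop_of_invariant (e := .cell (.const 2))
    (p := .seq (.store (.const 2) (.sub (.cell (.const 2)) (.const 1)))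
        (.store (.add (.cell (.const 0)) (.const 3))
          (.add (.cell (.add (.cell (.const 0)) (.const 3))) (.cell (.const 0)))))
    (t := 20) (N := n)
    (fun q m' => m' = Function.update (Function.update m 2 (n - q)) (n + 3) (q * n))
    (m := Function.update m 2 n) ?_ ?_ ?_).elim ?_
  rotate_left 3
  · rintro t ⟨ht, _, hr, rfl⟩
    have h1 : Runs (.store (.const 2) (.cell (.const 0))) m 4 (Function.update m 2 n) :=
      Runs.store_of_eval rfl h0
    have h4 := h1.seq hr
    rw [Nat.sub_self] at h4
    have h5 : Function.update m 2 0 = m := by rw [← h2, Function.update_eq_self]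
    rw [h5] at h4
    refine ⟨4 + t, ?_, h4⟩
    simp only [Expr.cost] at ht
    omega
  · rintro q hq _ rfl
    set m' := Function.update (Function.update m 2 (n - q)) (n + 3) (q * n) with hm'
    have hm2 : m' 2 = n - q := by
      rw [hm', Function.update_of_ne (by omega), Function.update_self]
    have hm0 : m' 0 = n := by
      rw [hm', Function.update_of_ne (by omega), Function.update_of_ne (by omega), h0]
    have hm3 : m' (n + 3) = q * n := by rw [hm', Function.update_self]
    have h4 : Runs (.store (.const 2) (.sub (.cell (.const 2)) (.const 1))) m' 6
        (Function.update m' 2 (n - q - 1)) := Runs.store_of_eval rfl (by simp [Expr.eval, hm2])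
    have h5 : Runs (.store (.add (.cell (.const 0)) (.const 3))
          (.add (.cell (.add (.cell (.const 0)) (.const 3))) (.cell (.const 0))))
        (Function.update m' 2 (n - q - 1)) 13
        (Function.update (Function.update m' 2 (n - q - 1)) (n + 3) (q * n + n)) :=
      Runs.store_of_eval (by simp [Expr.eval, hm0]) (by simp [Expr.eval, hm0, hm3])
    refine ⟨by simp only [Expr.eval, hm2]; omega, _, by omega, _, h4.seq h5, ?_⟩
    funext a
    simp only [hm', Function.update_apply]
    rw [Nat.succ_mul, Nat.sub_add_eq]
    split_ifs <;> rfl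
  · rintro _ rfl
    simp [Expr.eval]
  · rw [Nat.sub_zero, zero_mul]
    have h5 : Function.update (Function.update m 2 n) (n + 3) 0 = Function.update m 2 n := by
      rw [Function.update_eq_iff]
      refine ⟨?_, fun _ _ => rfl⟩
      rw [Function.update_of_ne (by omega), h3]
    exact h5.symm

open RAM.Expr in
/-- The base address. -/
abbrev baseAddr : Expr :=
  .add (.add (cell (.add (cell (.const 0)) (.const 3))) (cell (.const 0))) (.const 4)

open RAM.Expr in
/-- Set up the layout, with the number of vertices, the parameter and the size of the matrix in
registers. -/
def setupLayout : Program :=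
  .seq (.store baseAddr (cell (.const 0)))
    (.seq (.store (.add baseAddr (.const 1)) (cell (.const 1)))
      (.seq (.store (.add baseAddr (.const 14)) (cell (.add (cell (.const 0)) (.const 3))))
        (.seq (.store (.const 0) baseAddr)
          (.store (.add (cell (cell (.const 0))) (.const 3)) (.const 0)))))

/-- The store that holds the number of vertices, the parameter and the size of the matrix. -/
def initialStore (n k : ℕ) : Store :=
  ((Store.set (fun _ _ => 0) rN 0 n).set rK 0 k).set rCnt 0 (n * n)

theorem exists_runs_setupLayout : ∃ C, ∀ (n k : ℕ) (m : Memory), m 0 = n → m 1 = k →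
    m (n + 3) = 0 → (∀ a, n * n + 2 ≤ a → m a = 0) →
    ∃ t ≤ C, Runs setupLayout (Function.update m (n + 3) (n * n)) t
      (layout (n * n + n + 4) m (initialStore n k)) := by
  refine ⟨100, fun n k m h0 h1 h3 hz => ?_⟩
  rw [initialStore]
  generalize hnn : n * n = y at hz ⊢
  obtain ⟨b, hb⟩ : ∃ b, b = y + n + 4 := ⟨_, rfl⟩
  rw [← hb]
  set M₀ := Function.update m (n + 3) y with hM₀
  have h00 : M₀ 0 = n := by rw [hM₀, Function.update_of_ne (by omega), h0]
  have h01 : M₀ 1 = k := by rw [hM₀, Function.update_of_ne (by omega), h1]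
  have h03 : M₀ (n + 3) = y := by rw [hM₀, Function.update_self]
  have r1 : Runs (.store baseAddr (.cell (.const 0))) M₀ 13 (Function.update M₀ b n) :=
    Runs.store_of_eval (by simp [Expr.eval, h00, h03, hb]) (by simp [Expr.eval, h00])
  set M₁ := Function.update M₀ b n with hM₁
  have h10 : M₁ 0 = n := by rw [hM₁, Function.update_of_ne (by omega), h00]
  have h11 : M₁ 1 = k := by rw [hM₁, Function.update_of_ne (by omega), h01]
  have h13 : M₁ (n + 3) = y := by rw [hM₁, Function.update_of_ne (by omega), h03]
  have r2 : Runs (.store (.add baseAddr (.const 1)) (.cell (.const 1))) M₁ 15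
      (Function.update M₁ (b + 1) k) :=
    Runs.store_of_eval (by simp [Expr.eval, h10, h13, hb]) (by simp [Expr.eval, h11])
  set M₂ := Function.update M₁ (b + 1) k with hM₂
  have h20 : M₂ 0 = n := by rw [hM₂, Function.update_of_ne (by omega), h10]
  have h23 : M₂ (n + 3) = y := by rw [hM₂, Function.update_of_ne (by omega), h13]
  have r3 : Runs (.store (.add baseAddr (.const 14)) (.cell (.add (.cell (.const 0)) (.const 3))))
      M₂ 18 (Function.update M₂ (b + 14) y) :=
    Runs.store_of_eval (by simp [Expr.eval, h20, h23, hb]) (by simp [Expr.eval, h20, h23])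
  set M₃ := Function.update M₂ (b + 14) y with hM₃
  have h30 : M₃ 0 = n := by rw [hM₃, Function.update_of_ne (by omega), h20]
  have h33 : M₃ (n + 3) = y := by rw [hM₃, Function.update_of_ne (by omega), h23]
  have r4 : Runs (.store (.const 0) baseAddr) M₃ 12 (Function.update M₃ 0 b) :=
    Runs.store_of_eval rfl (by simp [Expr.eval, h30, h33, hb])
  set M₄ := Function.update M₃ 0 b with hM₄
  have h40 : M₄ 0 = b := by rw [hM₄, Function.update_self]
  have h4b : M₄ b = n := by
    rw [hM₄, Function.update_of_ne (by omega), hM₃, Function.update_of_ne (by omega), hM₂,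
      Function.update_of_ne (by omega), hM₁, Function.update_self]
  have r5 : Runs (.store (.add (.cell (.cell (.const 0))) (.const 3)) (.const 0)) M₄ 7
      (Function.update M₄ (n + 3) 0) :=
    Runs.store_of_eval (by simp [Expr.eval, h40, h4b]) rfl
  have hmem : layout b m (((Store.set (fun _ _ => 0) rN 0 n).set rK 0 k).set rCnt 0 y) =
      Function.update M₄ (n + 3) 0 := by
    have hb0 : 0 < b := by omega
    rw [← update_layout_array hb0 m _ rCnt 0 y, ← update_layout_array hb0 m _ rK 0 k,
      ← update_layout_array hb0 m (fun _ _ => 0) rN 0 n]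
    funext a
    simp only [hM₄, hM₃, hM₂, hM₁, hM₀, Function.update_apply, layout]
    simp only [Fin.isValue, Fin.val_zero, Fin.val_one, mul_zero, add_zero]
    have h14 : ((14 : Fin 22) : ℕ) = 14 := rfl
    rw [h14]
    split_ifs <;> first | rfl | omega | skip
    all_goals first | (subst_vars; omega) | (rw [hz _ (by omega)])
  rw [hmem]
  exact ⟨13 + (15 + (18 + (12 + 7))), by norm_num, r1.seq (r2.seq (r3.seq (r4.seq r5)))⟩

open SExpr in
/-- Copy the adjacency matrix. -/
def copyMatrix : Program :=
  .loop (reg rCnt).compile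
    (.seq (Block.setReg rCnt (sub (reg rCnt) (.const 1))).compile
      (.store (arrayAddr aAdj (reg rCnt).compile) (.cell (.add (.const 2) (reg rCnt).compile))))

theorem exists_runs_copyMatrix : ∃ C, ∀ (b y : ℕ) (low : ℕ → ℕ) (v : Store), y + 2 ≤ b →
    v rCnt 0 = y → ∃ t ≤ C * (y + 1), ∃ v', Runs copyMatrix (layout b low v) t (layout b low v') ∧
      AgreeOff [rCnt, aAdj] v v' ∧ ∀ x < y, v' aAdj x = low (2 + x) := by
  refine ⟨(Block.setReg rCnt (.sub (.reg rCnt) (.const 1))).time +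
    ((arrayAddr aAdj (SExpr.reg rCnt).compile).cost +
      (Expr.cell (.add (.const 2) (SExpr.reg rCnt).compile)).cost + 1) +
    (SExpr.reg rCnt).compile.cost + 1, fun b y low v hb hcnt => ?_⟩
  · have hb0 : 0 < b := by omega
    refine (Runs.loop_of_invariant (e := (SExpr.reg rCnt).compile)
      (p := .seq (Block.setReg rCnt (.sub (.reg rCnt) (.const 1))).compile
        (.store (arrayAddr aAdj (SExpr.reg rCnt).compile)
          (.cell (.add (.const 2) (SExpr.reg rCnt).compile))))
      (t := (Block.setReg rCnt (.sub (.reg rCnt) (.const 1))).time +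
        ((arrayAddr aAdj (SExpr.reg rCnt).compile).cost +
          (Expr.cell (.add (.const 2) (SExpr.reg rCnt).compile)).cost + 1)) (N := y)
      (fun q m => ∃ w, m = layout b low w ∧ AgreeOff [rCnt, aAdj] v w ∧ w rCnt 0 = y - q ∧
        ∀ x < y, y - q ≤ x → w aAdj x = low (2 + x))
      (m := layout b low v) ?_ ?_ ?_).elim ?_
    rotate_left 3
    · rintro t ⟨ht, _, hr, w, rfl, ha, -, hw⟩
      rw [mul_comm] at ht
      exact ⟨t, ht, w, hr, ha, fun x hx => hw x hx (by omega)⟩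
    · rintro q hq _ ⟨w, rfl, ha, hc, hw⟩
      refine ⟨by rw [SExpr.eval_compile hb0]; simp [SExpr.eval, hc]; omega, ?_⟩
      have hrun : (Block.setReg rCnt (.sub (.reg rCnt) (.const 1))).run w =
          w.set rCnt 0 (y - (q + 1)) := by
        simp [Block.run, SExpr.eval, hc, Nat.sub_add_eq]
      obtain ⟨s, hs, hr⟩ := (Block.setReg rCnt (.sub (.reg rCnt) (.const 1))).exec w b low hb0
      rw [hrun] at hr
      set w₁ := w.set rCnt 0 (y - (q + 1)) with hw₁
      have hc₁ : (SExpr.reg rCnt).compile.eval (layout b low w₁) = y - (q + 1) := by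
        rw [SExpr.eval_compile hb0]
        simp [SExpr.eval, hw₁, Store.set_apply]
      have hstore : Runs (.store (arrayAddr aAdj (SExpr.reg rCnt).compile)
          (.cell (.add (.const 2) (SExpr.reg rCnt).compile))) (layout b low w₁)
          ((arrayAddr aAdj (SExpr.reg rCnt).compile).cost +
            (Expr.cell (.add (.const 2) (SExpr.reg rCnt).compile)).cost + 1)
          (layout b low (w₁.set aAdj (y - (q + 1)) (low (2 + (y - (q + 1)))))) := by
        rw [← update_layout_array hb0 low w₁]
        refine Runs.store_of_eval ?_ ?_
        · rw [eval_arrayAddr, hc₁]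
        · simp only [Expr.eval, hc₁]
          exact layout_low _ _ (by omega) (by omega)
      refine ⟨_, Nat.add_le_add_right hs _, _, hr.seq hstore, _, rfl, ?_, ?_, ?_⟩
      · exact (ha.set (by simp) _ _).set (by simp) _ _
      · simp [hw₁, Store.set_apply]
      · intro x hx hqx
        by_cases hxe : x = y - (q + 1)
        · simp [Store.set_apply, hxe]
        · simpa [hw₁, Store.set_apply, hxe] using hw x hx (by omega)
    · rintro _ ⟨w, rfl, -, hc, -⟩
      rw [SExpr.eval_compile hb0]
      simp [SExpr.eval, hc]
    · exact ⟨v, rfl, .refl _ _, by rw [hcnt, Nat.sub_zero], fun x hx hx' => by omega⟩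

open SExpr Block in
/-- The list that consists of the empty set. -/
def initLists : Block :=
  .seq (wr aPow (.const 0) (.const 1))
    (.seq (setReg rAlive (.const 1)) (setReg rHi (.const 1)))

/-- The algorithm: it either outputs an ordering of width at most `k`, or writes `0` to cell `0`. -/
def cutwidthProgram : Program :=
  .seq square (.seq setupLayout (.seq copyMatrix (.seq initLists.compile (.seq allStages
    (.ite (SExpr.reg rAlive).compile trace (.store (.const 0) (.const 0)))))))

theorem exists_runs_cutwidthProgram : ∃ C, ∀ (adj : ℕ → ℕ → Prop) (k n X : ℕ) (m : Memory),
    m 0 = n → m 1 = k → m 2 = 0 → m (n + 3) = 0 → (∀ a, n * n + 2 ≤ a → m a = 0) →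
    (∀ u < n, ∀ w < n, adj u w → m (2 + (u * n + w)) = 1) →
    (∀ u < n, ∀ w < n, ¬ adj u w → m (2 + (u * n + w)) = 0) → ReachableBound adj k n X →
    ∃ t ≤ C * ((n + 2) ^ 3 * (X + 1)), ∃ m', Runs cutwidthProgram m t m' ∧
      ((m' 0 = 1 ∧ ∃ S : ℕ → Finset ℕ, (∀ t ≤ n, Reachable adj k n (S t) ∧ (S t).card = t) ∧
          ∀ t < n, m' (1 + t) ∈ S (t + 1) ∧ S t = (S (t + 1)).erase (m' (1 + t))) ∨
        (m' 0 = 0 ∧ ¬ Reachable adj k n (Finset.range n))) := by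
  obtain ⟨C₁, hC₁⟩ := exists_runs_square
  obtain ⟨C₂, hC₂⟩ := exists_runs_setupLayout
  obtain ⟨C₃, hC₃⟩ := exists_runs_copyMatrix
  obtain ⟨C₄, hC₄⟩ := exists_exec_allStages
  obtain ⟨C₅, hC₅⟩ := exists_runs_trace
  refine ⟨C₁ + C₂ + C₃ + initLists.time + C₄ + (SExpr.reg rAlive).compile.cost + C₅ + 4,
    fun adj k n X m h0 h1 h2 h3 hz harc hno hX => ?_⟩
  obtain ⟨t₁, ht₁, hr₁⟩ := hC₁ n m h0 h2 h3
  obtain ⟨t₂, ht₂, hr₂⟩ := hC₂ n k m h0 h1 h3 hz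
  have hidx : ∀ u < n, ∀ w < n, u * n + w < n * n := fun u hu w hw => by
    have := Nat.mul_le_mul_right n (Nat.succ_le_of_lt hu)
    rw [Nat.succ_mul] at this
    omega
  generalize hbdef : n * n + n + 4 = b at hr₂
  have hb0 : 0 < b := by omega
  obtain ⟨t₃, ht₃, v₃, hr₃, ha₃, hadj₃⟩ := hC₃ b (n * n) m (initialStore n k) (by omega)
    (by simp [initialStore, Store.set_apply])
  obtain ⟨t₄, ht₄, hr₄⟩ := initLists.exec v₃ b m hb0
  have hrun : initLists.run v₃ = ((v₃.set aPow 0 1).set rAlive 0 1).set rHi 0 1 := rfl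
  set v₄ := initLists.run v₃ with hv₄
  have hv₃ : ∀ j, j ∉ [rN, rK, rCnt, aAdj] → ∀ x, v₃ j x = 0 := by
    intro j hj x
    simp only [List.mem_cons, not_or] at hj
    rw [ha₃ j (by simp [hj])]
    simp [initialStore, Store.set_apply, hj]
  have htab : HasTables adj k n 0 v₄ := by
    rw [hrun]
    constructor
    · simp only [Store.set_apply]
      simp [ha₃ rN (by simp), initialStore, Store.set_apply]
    · simp only [Store.set_apply]
      simp [ha₃ rK (by simp), initialStore, Store.set_apply]
    · simpa [Store.set_apply] using hv₃ rI (by simp) 0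
    · intro u hu
      obtain rfl : u = 0 := by omega
      simp [Store.set_apply]
    · intro u hu
      obtain rfl : u = 0 := by omega
      simpa [Store.set_apply] using hv₃ aRow (by simp) 0
    · intro u hu w hw h
      simp only [Store.set_apply]
      simp [hadj₃ _ (hidx u hu w hw), harc u hu w hw h]
    · intro u hu w hw h
      simp only [Store.set_apply]
      simp [hadj₃ _ (hidx u hu w hw), hno u hu w hw h]
  have hlists : ListsReachable adj k 0 0 [∅] v₄ := by
    have hempty : ∀ B, Reachable adj k 0 B → B = ∅ := fun B hB => by
      simpa using hB.subset
    rw [hrun]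
    constructor
    · simp
    · intro B
      rw [List.mem_singleton]
      exact ⟨fun h => h ▸ .empty, hempty B⟩
    · simpa [Store.set_apply] using hv₃ rLo (by simp) 0
    · simp [Store.set_apply]
    · intro q hq
      obtain rfl : q = 0 := by simpa using hq
      simpa [Store.set_apply, setCode_empty] using hv₃ aList (by simp) 0
    · intro c
      simpa [Store.set_apply] using (hv₃ aMark (by simp) c).le
    · intro B hne hB
      exact absurd (hempty B hB) hne
  obtain ⟨v₅, hx₅, htab₅, halive₅, hlists₅⟩ := hC₄ adj k n 0 X [∅] v₄ htab
    (by simp [hrun, Store.set_apply]) hlists hX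
  obtain ⟨t₅, ht₅, hr₅⟩ := hx₅ b m hb0
  have hy1 : 1 ≤ (n + 2) ^ 3 * (X + 1) := Nat.mul_pos (by positivity) (by omega)
  have hyn : n + 1 ≤ (n + 2) ^ 3 * (X + 1) := by
    nlinarith [Nat.zero_le n, Nat.zero_le X, Nat.zero_le ((n + 2) ^ 3 * X), Nat.zero_le (n ^ 3)]
  have hynn : n * n + 1 ≤ (n + 2) ^ 3 * (X + 1) := by
    nlinarith [Nat.zero_le n, Nat.zero_le X, Nat.zero_le ((n + 2) ^ 3 * X), Nat.zero_le (n ^ 3)]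
  generalize (n + 2) ^ 3 * (X + 1) = y at hy1 hyn hynn ht₅ ⊢
  have g1 := ht₁.trans (Nat.mul_le_mul_left C₁ hyn)
  have g2 := ht₂.trans (Nat.le_mul_of_pos_right C₂ hy1)
  have g3 := ht₃.trans (Nat.mul_le_mul_left C₃ hynn)
  have g4 := ht₄.trans (Nat.le_mul_of_pos_right _ hy1)
  have g6 := Nat.le_mul_of_pos_right (SExpr.reg rAlive).compile.cost hy1
  by_cases halive : v₅ rAlive 0 = 0
  · have hst : Runs (.store (.const 0) (.const 0)) (layout b m v₅) 3
        (Function.update (layout b m v₅) 0 0) := Runs.store_of_eval rfl rfl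
    refine ⟨_, ?_, _, hr₁.seq (hr₂.seq (hr₃.seq (hr₄.seq (hr₅.seq
      (.ite_false (by rw [SExpr.eval_compile hb0]; exact halive) hst))))), .inr ⟨by simp, ?_⟩⟩
    · simp only [Nat.add_mul]
      omega
    · exact fun h => halive₅.2 h halive
  · obtain ⟨lo, l, hl⟩ := hlists₅ halive
    obtain ⟨t₆, ht₆, m', hr₆, h⟩ := hC₅ adj k n lo b l m v₅ (by omega) htab₅ hl (halive₅.1 halive)
    refine ⟨_, ?_, m', hr₁.seq (hr₂.seq (hr₃.seq (hr₄.seq (hr₅.seq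
      (.ite_true (by rw [SExpr.eval_compile hb0]; exact halive) hr₆))))), .inl h⟩
    have g7 := ht₆.trans (Nat.mul_le_mul_left C₅ hyn)
    simp only [Nat.add_mul]
    omega

end RAM

/-! ## Orderings of a digraph and the main theorem -/

section Orderings

open Finset

variable {n : ℕ} (T : Digraph (Fin n))

/-- The adjacency relation of `T` on the natural numbers. -/
def Digraph.natAdj (u w : ℕ) : Prop := ∃ (hu : u < n) (hw : w < n), T.Adj ⟨u, hu⟩ ⟨w, hw⟩

theorem Digraph.natAdj_val (u w : Fin n) : T.natAdj u w ↔ T.Adj u w :=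
  ⟨fun ⟨_, _, h⟩ => h, fun h => ⟨u.isLt, w.isLt, h⟩⟩

theorem Digraph.card_backArcs (A : Finset (Fin n)) :
    (backArcs T.natAdj n (A.map Fin.valEmbedding)).card = (T.arcsBetween Aᶜ A).card := by
  classical
  symm
  refine card_bij (fun e _ => ((e.1 : ℕ), (e.2 : ℕ))) ?_ ?_ ?_
  · rintro ⟨u, w⟩ h
    simp only [arcsBetween, mem_filter, mem_product, mem_compl] at h
    simp only [mem_backArcs, natAdj_val, mem_map, Fin.valEmbedding_apply]
    refine ⟨⟨u.isLt, w.isLt⟩, h.2, ?_, w, h.1.2, rfl⟩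
    rintro ⟨x, hx, hxu⟩
    exact h.1.1 (Fin.ext hxu ▸ hx)
  · rintro ⟨u, w⟩ _ ⟨u', w'⟩ _ h
    simp only [Prod.mk.injEq] at h
    exact Prod.ext (Fin.ext h.1) (Fin.ext h.2)
  · rintro ⟨u, w⟩ h
    obtain ⟨⟨hu, hw⟩, h1, h2, h3⟩ := mem_backArcs.1 h
    simp only at hu hw h1 h2 h3
    refine ⟨(⟨u, hu⟩, ⟨w, hw⟩), ?_, rfl⟩
    simp only [arcsBetween, mem_filter, mem_product, mem_compl]
    refine ⟨⟨fun hx => h2 (mem_map.2 ⟨_, hx, rfl⟩), ?_⟩, (T.natAdj_val ⟨u, hu⟩ ⟨w, hw⟩).1 h1⟩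
    obtain ⟨x, hx, hxw⟩ := mem_map.1 h3
    have : x = ⟨w, hw⟩ := Fin.ext hxw
    exact this ▸ hx

variable {T}

theorem Digraph.card_backArcs_orderPrefix_le {k : ℕ} {σ : Equiv.Perm (Fin n)}
    (h : T.orderWidth σ ≤ k) (t : ℕ) :
    (backArcs T.natAdj n ((orderPrefix σ t).map Fin.valEmbedding)).card ≤ k := by
  rw [T.card_backArcs]
  rcases Nat.eq_zero_or_pos t with rfl | ht0
  · simp [orderPrefix, Digraph.arcsBetween]
  rcases Nat.lt_or_ge t n with ht | ht
  · exact (Finset.le_sup (f := fun t => (T.arcsBetween (orderPrefix σ t)ᶜ (orderPrefix σ t)).card)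
      (mem_Ico.2 ⟨ht0, ht⟩)).trans h
  · have : orderPrefix σ t = univ := by
      ext v
      simp only [orderPrefix, mem_filter, mem_univ, true_and, iff_true]
      omega
    simp [this, Digraph.arcsBetween]

theorem Digraph.reachable_of_orderWidth_le {k : ℕ} {σ : Equiv.Perm (Fin n)}
    (h : T.orderWidth σ ≤ k) : Reachable T.natAdj k n (range n) := by
  have key : ∀ t ≤ n, Reachable T.natAdj k n ((orderPrefix σ t).map Fin.valEmbedding) := by
    intro t
    induction t with
    | zero =>
      intro _
      simp only [orderPrefix, Nat.not_lt_zero, filter_false, map_empty]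
      exact .empty
    | succ t ih =>
      intro ht
      have hstep : (orderPrefix σ (t + 1)).map Fin.valEmbedding =
          insert (σ ⟨t, ht⟩ : ℕ) ((orderPrefix σ t).map Fin.valEmbedding) := by
        rw [← Fin.valEmbedding_apply, ← map_insert]
        congr 1
        ext v
        simp only [orderPrefix, mem_filter, mem_univ, true_and, mem_insert]
        rw [← Equiv.symm_apply_eq, Fin.ext_iff]
        simp only
        omega
      have hw := card_backArcs_orderPrefix_le h (t + 1)
      rw [hstep] at hw ⊢
      refine (ih (by omega)).grow _ _ (σ ⟨t, ht⟩).isLt ?_ hw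
      intro hmem
      obtain ⟨x, hx, hxe⟩ := mem_map.1 hmem
      have : x = σ ⟨t, ht⟩ := Fin.ext hxe
      simp [orderPrefix, this] at hx
  have hfull : (orderPrefix σ n).map Fin.valEmbedding = range n := by
    ext v
    simp [orderPrefix]
  rw [← hfull]
  exact key n le_rfl

theorem Digraph.exists_perm_of_chain {k : ℕ} {S : ℕ → Finset ℕ} {e : ℕ → ℕ}
    (hS : ∀ t ≤ n, Reachable T.natAdj k n (S t) ∧ (S t).card = t)
    (he : ∀ t < n, e t ∈ S (t + 1) ∧ S t = (S (t + 1)).erase (e t)) :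
    ∃ σ : Equiv.Perm (Fin n), (∀ i : Fin n, e i = (σ i : ℕ)) ∧ T.orderWidth σ ≤ k := by
  have himage : ∀ t ≤ n, S t = (range t).image e := by
    intro t
    induction t with
    | zero =>
      intro _
      rw [range_zero, image_empty, ← card_eq_zero]
      exact (hS 0 (Nat.zero_le n)).2
    | succ t ih =>
      intro ht
      obtain ⟨h1, h2⟩ := he t ht
      rw [range_add_one, image_insert, ← ih (by omega), h2, insert_erase h1]
  have hinj : Set.InjOn e (range n) := by
    rw [← card_image_iff, ← himage n le_rfl, card_range]
    exact (hS n le_rfl).2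
  have hlt : ∀ i : Fin n, e i < n := fun i => by
    have h1 := (hS (i + 1) i.isLt).1.subset (he i i.isLt).1
    exact mem_range.1 h1
  have hbij : Function.Bijective fun i : Fin n => (⟨e i, hlt i⟩ : Fin n) := by
    rw [← Finite.injective_iff_bijective]
    intro i j hij
    exact Fin.ext (hinj (by simp) (by simp) (congrArg Fin.val hij))
  refine ⟨Equiv.ofBijective _ hbij, fun i => rfl, Finset.sup_le fun t ht => ?_⟩
  have htn : t ≤ n := (mem_Ico.1 ht).2.le
  have hpre : (orderPrefix (Equiv.ofBijective _ hbij) t).map Fin.valEmbedding = S t := ?_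
  · rw [← T.card_backArcs, hpre]
    exact (hS t htn).1.card_le
  rw [himage t htn]
  ext v
  simp only [orderPrefix, mem_map, mem_filter, mem_univ, true_and, Fin.valEmbedding_apply,
    mem_image, mem_range]
  constructor
  · rintro ⟨x, hx, rfl⟩
    obtain ⟨i, rfl⟩ := (Equiv.ofBijective _ hbij).surjective x
    rw [Equiv.symm_apply_apply] at hx
    exact ⟨i, hx, rfl⟩
  · rintro ⟨i, hi, rfl⟩
    refine ⟨Equiv.ofBijective _ hbij ⟨i, by omega⟩, ?_, rfl⟩
    rwa [Equiv.symm_apply_apply]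

end Orderings

/-- The bound on the number of reachable sets, rounded down. -/
noncomputable def reachableCount (k n : ℕ) : ℕ :=
  ⌊((n : ℝ) + 1) * Real.exp (2 * narrowScale (2 * k) + 1) ^ 2⌋₊

theorem Digraph.IsSemicomplete.reachableBound {n : ℕ} {T : Digraph (Fin n)}
    (hT : T.IsSemicomplete) (k : ℕ) :
    RAM.ReachableBound T.natAdj k n (reachableCount k n) := by
  intro i hi hr
  refine Nat.le_floor ((card_reachable_le ?_ hr).trans ?_)
  · intro x hx y hy hxy
    refine (hT.2 ⟨x, by omega⟩ ⟨y, by omega⟩ fun h => hxy (congrArg Fin.val h)).imp ?_ ?_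
    · exact fun h => ⟨_, _, h⟩
    · exact fun h => ⟨_, _, h⟩
  · gcongr

theorem exists_time_bound (C : ℕ) : ∃ c : ℕ, ∀ k n : ℕ,
    ((C * ((n + 2) ^ 3 * (reachableCount k n + 1)) : ℕ) : ℝ) ≤
      (c : ℝ) * (2 : ℝ) ^ ((c : ℝ) * Real.sqrt ((k : ℝ) * Real.log (k : ℝ))) *
        ((n : ℝ) + 1) ^ c := by
  obtain ⟨a, ha, hscale⟩ := exists_narrowScale_le
  obtain ⟨c, hc⟩ := exists_nat_ge (max (max (16 * C * Real.exp (4 * a + 2)) (8 * a)) 4)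
  refine ⟨c, fun k n => ?_⟩
  have hc1 : 16 * C * Real.exp (4 * a + 2) ≤ c := (le_max_left _ _).trans ((le_max_left _ _).trans hc)
  have hc2 : 8 * a ≤ c := (le_max_right _ _).trans ((le_max_left _ _).trans hc)
  have hc3 : 4 ≤ c := by exact_mod_cast (le_max_right _ _).trans hc
  set s := Real.sqrt ((k : ℝ) * Real.log (k : ℝ)) with hs
  have hs0 : 0 ≤ s := Real.sqrt_nonneg _
  have hn1 : (1 : ℝ) ≤ (n : ℝ) + 1 := by linarith [(Nat.cast_nonneg n : (0 : ℝ) ≤ n)]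
  have hscale0 : 0 ≤ narrowScale (2 * k) := Real.sqrt_nonneg _
  have hE : Real.exp (2 * narrowScale (2 * k) + 1) ^ 2 ≤
      Real.exp (4 * a + 2) * (2 : ℝ) ^ ((c : ℝ) * s) := by
    rw [← Real.exp_nat_mul, Real.rpow_def_of_pos two_pos, ← Real.exp_add, Real.exp_le_exp]
    have h1 := hscale k
    have h2 := Real.log_two_gt_d9
    have h3 : 4 * (a * s) ≤ Real.log 2 * (c * s) := by
      have h4 : 8 * a * s ≤ c * s := mul_le_mul_of_nonneg_right hc2 hs0
      have h5 : 0 ≤ c * s := mul_nonneg (Nat.cast_nonneg c) hs0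
      nlinarith
    push_cast
    linarith
  have hE1 : 1 ≤ Real.exp (2 * narrowScale (2 * k) + 1) ^ 2 :=
    one_le_pow₀ (Real.one_le_exp (by linarith))
  have hcount : (reachableCount k n : ℝ) + 1 ≤
      2 * (((n : ℝ) + 1) * (Real.exp (4 * a + 2) * (2 : ℝ) ^ ((c : ℝ) * s))) := by
    have h1 : (reachableCount k n : ℝ) ≤ _ := Nat.floor_le (by positivity)
    have h2 := mul_le_mul_of_nonneg_left hE (zero_le_one.trans hn1)
    have h3 := one_le_mul_of_one_le_of_one_le hn1 hE1
    linarith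
  push_cast
  calc (C : ℝ) * (((n : ℝ) + 2) ^ 3 * ((reachableCount k n : ℝ) + 1))
      ≤ C * ((2 * ((n : ℝ) + 1)) ^ 3 *
          (2 * (((n : ℝ) + 1) * (Real.exp (4 * a + 2) * (2 : ℝ) ^ ((c : ℝ) * s))))) := by
        gcongr
        linarith
    _ = 16 * C * Real.exp (4 * a + 2) * (2 : ℝ) ^ ((c : ℝ) * s) * ((n : ℝ) + 1) ^ 4 := by ring
    _ ≤ _ := by gcongr

theorem RAM.inputMemory_arc {n : ℕ} (T : Digraph (Fin n)) (k : ℕ) (u w : Fin n) :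
    inputMemory T k (2 + ((u : ℕ) * n + w)) = 1 ↔ T.Adj u w := by
  have h0 : 2 + ((u : ℕ) * n + w) ≠ 0 := by omega
  have h1 : 2 + ((u : ℕ) * n + w) ≠ 1 := by omega
  simp only [inputMemory, h0, h1, if_false]
  constructor
  · intro h
    split_ifs at h with hex
    obtain ⟨u', w', heq, hadj⟩ := hex
    have hn : 0 < n := u.pos
    have heq' : (w : ℕ) + n * u = w' + n * u' := by rw [mul_comm n, mul_comm n]; omega
    have hw : (w : ℕ) = w' := by
      have := congrArg (· % n) heq'
      simpa [Nat.mod_eq_of_lt w.isLt, Nat.mod_eq_of_lt w'.isLt] using this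
    have hu : (u : ℕ) = u' := by
      have : n * (u : ℕ) = n * u' := by omega
      exact Nat.eq_of_mul_eq_mul_left hn this
    rwa [Fin.ext hu, Fin.ext hw]
  · exact fun h => if_pos ⟨u, w, rfl, h⟩

theorem RAM.inputMemory_eq_zero {n : ℕ} (T : Digraph (Fin n)) (k : ℕ) {a : ℕ} (ha : 2 ≤ a)
    (h : ∀ u w : Fin n, a = 2 + ((u : ℕ) * n + w) → ¬ T.Adj u w) : inputMemory T k a = 0 := by
  have h0 : a ≠ 0 := by omega
  have h1 : a ≠ 1 := by omega
  simp only [inputMemory, h0, h1, if_false]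
  exact if_neg fun ⟨u, w, he, hadj⟩ => h u w he hadj

theorem theorem3 :
    ∃ (P : RAM.Program) (c : ℕ),
      ∀ (n : ℕ) (T : Digraph (Fin n)), T.IsSemicomplete → ∀ k : ℕ,
        ∃ (t : ℕ) (m : RAM.Memory),
          RAM.Runs P (RAM.inputMemory T k) t m ∧
          (t : ℝ) ≤ (c : ℝ) * (2 : ℝ) ^ ((c : ℝ) * Real.sqrt ((k : ℝ) * Real.log (k : ℝ)))
            * ((n : ℝ) + 1) ^ c ∧
          ((∃ σ : Equiv.Perm (Fin n), RAM.OutputsOrdering m σ ∧ T.orderWidth σ ≤ k) ∨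
            (RAM.OutputsNo m ∧ k < T.cutwidth)) := by
  obtain ⟨C, hC⟩ := RAM.exists_runs_cutwidthProgram
  obtain ⟨c, hc⟩ := exists_time_bound C
  refine ⟨RAM.cutwidthProgram, c, fun n T hT k => ?_⟩
  have hdiag : ∀ u w : Fin n, (u : ℕ) = w → ¬ T.Adj u w := fun u w h => by
    rw [Fin.ext h]
    exact hT.1 w
  obtain ⟨t, ht, m, hr, hm⟩ := hC T.natAdj k n (reachableCount k n) (RAM.inputMemory T k)
    (by simp [RAM.inputMemory]) (by simp [RAM.inputMemory])
    (by
      refine RAM.inputMemory_eq_zero T k le_rfl fun u w h => hdiag u w ?_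
      have hn := u.pos
      have h1 : (u : ℕ) * n = 0 := by omega
      rcases Nat.mul_eq_zero.1 h1 with h2 | h2 <;> omega)
    (by
      refine RAM.inputMemory_eq_zero T k (by omega) fun u w h => hdiag u w ?_
      have hw := w.isLt
      have h1 : (u : ℕ) * n + w = n + 1 := by omega
      rcases Nat.lt_trichotomy (u : ℕ) 1 with h2 | h2 | h2
      · have h3 : (u : ℕ) = 0 := by omega
        rw [h3] at h1
        omega
      · rw [h2] at h1 ⊢
        omega
      · have h3 := Nat.mul_le_mul_right n h2
        have h4 := u.isLt
        rw [Nat.succ_mul, one_mul] at h3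
        omega)
    (by
      intro a ha
      refine RAM.inputMemory_eq_zero T k (by omega) fun u w h => ?_
      have h3 := Nat.mul_le_mul_right n (Nat.succ_le_of_lt u.isLt)
      have h4 := w.isLt
      rw [Nat.succ_mul] at h3
      omega)
    (by
      rintro u hu w hw ⟨_, _, h⟩
      exact (RAM.inputMemory_arc T k ⟨u, hu⟩ ⟨w, hw⟩).2 h)
    (by
      intro u hu w hw h
      have h1 := (RAM.inputMemory_arc T k ⟨u, hu⟩ ⟨w, hw⟩).not.2 fun h' => h ⟨hu, hw, h'⟩
      simp only [RAM.inputMemory] at h1 ⊢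
      split_ifs at h1 ⊢ <;> first | rfl | omega)
    (hT.reachableBound k)
  refine ⟨t, m, hr, le_trans (by exact_mod_cast ht) (hc k n), ?_⟩
  rcases hm with ⟨hm1, S, hS, he⟩ | ⟨hm0, hno⟩
  · obtain ⟨σ, hσ, hw⟩ := Digraph.exists_perm_of_chain (e := fun t => m (1 + t)) hS he
    exact .inl ⟨σ, ⟨hm1, hσ⟩, hw⟩
  · refine .inr ⟨hm0, lt_of_not_ge fun hle => ?_⟩
    obtain ⟨σ, hσ⟩ := ciInf_mem T.orderWidth
    exact hno (Digraph.reachable_of_orderWidth_le (σ := σ) (hσ.trans_le hle))
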